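/- Let $F$ be a field of characteristic zero. A Lie superalgebra is a $\mathbb{Z}_2$-graded algebra $L=L_0\oplus L_1$ over $F$ with $xy+(-1)^{|x||y|}yx=0$ and $x(yz)=(xy)z+(-1)^{|x||y|}y(xz)$ for all homogeneous $x,y,z$. Let $\mathcal{L}(X,Y)$ be the free Lie superalgebra on countably infinite sets $X=\{x_1,x_2,\dots\}$ of even and $Y=\{y_1,y_2,\dots\}$ of odd generators, let $P_{k,n-k}\subseteq\mathcal{L}(X,Y)$ be the subspace of multilinear polynomials in $x_1,\dots,x_k,y_1,\dots,y_{n-k}$, and let $Id^{gr}(L)$ be the set of all $f\in\mathcal{L}(X,Y)$ that vanish whenever the even generators are replaced by elements of $L_0$ and the odd generators by elements of $L_1$. The graded codimensions of $L$ are $$c_{k,n-k}(L)=\dim\frac{P_{k,n-k}}{P_{k,n-k}\cap Id^{gr}(L)},\qquad c_n^{gr}(L)=\sum_{k=0}^n\binom nk c_{k,n-k}(L).$$ Let $L=b(2)=L_0\oplus L_1$ be the Lie superalgebra of $4\times4$ matrices over $F$ with $$L_0=\left\{\begin{pmatrix}A&0\\0&-A^t\end{pmatrix} : A\in M_2(F),\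 \mathrm{tr}A=0\right\},\qquad L_1=\left\{\begin{pmatrix}0&B\\C&0\end{pmatrix} : B,C\in M_2(F),\ B^t=B,\ C^t=-C\right\}$$ and product $\{x,y\}=xy-(-1)^{|x||y|}yx$ for homogeneous $x,y$. Then for every integer $n\ge1$: (1) if $n-7$ is divisible by $6$, then $\displaystyle c_n^{gr}(b(2))\ge\frac{1}{3^{18}n^{38}}(3+2\sqrt3)^n$; (2) if $n-7\equiv i\pmod 6$ with $1\le i\le5$, then $\displaystyle c_n^{gr}(b(2))\ge\frac{1}{3^{18}n^{43}}(3+2\sqrt3)^n$. -/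

import Mathlib

noncomputable section

/-! ### Lie superalgebras -/

/-- A `ℤ/2`-graded (non-associative, bilinear) algebra `A = 𝒜 0 ⊕ 𝒜 1` over `F` is a Lie
superalgebra if its product, written `*`, satisfies super skew-symmetry and the super Jacobi
identity on homogeneous elements. -/
class IsLieSuperalgebra {F A : Type*} [Field F] [NonUnitalNonAssocRing A] [Module F A]
    [IsScalarTower F A A] [SMulCommClass F A A] (𝒜 : ZMod 2 → Submodule F A) : Prop where
  isInternal : DirectSum.IsInternal 𝒜
  mul_mem : ∀ {i j : ZMod 2} {x y : A}, x ∈ 𝒜 i → y ∈ 𝒜 j → x * y ∈ 𝒜 (i + j)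
  skew : ∀ {i j : ZMod 2} {x y : A}, x ∈ 𝒜 i → y ∈ 𝒜 j →
    x * y + (-1 : F) ^ (i.val * j.val) • (y * x) = 0
  jacobi : ∀ {i j k : ZMod 2} {x y z : A}, x ∈ 𝒜 i → y ∈ 𝒜 j → z ∈ 𝒜 k →
    x * (y * z) = (x * y) * z + (-1 : F) ^ (i.val * j.val) • (y * (x * z))

/-! ### The free Lie superalgebra on even generators `X` and odd generators `Y` -/

/-- The parity of a nonassociative word in even letters `X` and odd letters `Y`. -/
def wordParity {X Y : Type*} : FreeMagma (X ⊕ Y) → ZMod 2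
  | .of (.inl _) => 0
  | .of (.inr _) => 1
  | .mul u v => wordParity u + wordParity v

/-- The letters of a nonassociative word, with multiplicity. -/
def wordLetters {α : Type*} : FreeMagma α → Multiset α
  | .of a => {a}
  | .mul u v => wordLetters u + wordLetters v

/-- A nonassociative word as a monomial of the free nonassociative algebra. -/
def wordMonomial (F : Type*) [Field F] {α : Type*} (w : FreeMagma α) :
    FreeNonUnitalNonAssocAlgebra F α :=
  MonoidAlgebra.ofMagma F (FreeMagma α) w

/-- The defining relators of the free Lie superalgebra: super skew-symmetry and super Jacobi
for all words (by linearity this covers all homogeneous elements). -/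
inductive IsSuperRelator (F : Type*) [Field F] {X Y : Type*} :
    FreeNonUnitalNonAssocAlgebra F (X ⊕ Y) → Prop
  | skew (u v : FreeMagma (X ⊕ Y)) : IsSuperRelator F
      (wordMonomial F (u * v)
        + (-1 : F) ^ ((wordParity u).val * (wordParity v).val) • wordMonomial F (v * u))
  | jacobi (u v w : FreeMagma (X ⊕ Y)) : IsSuperRelator F
      (wordMonomial F (u * (v * w)) - (wordMonomial F ((u * v) * w)
        + (-1 : F) ^ ((wordParity u).val * (wordParity v).val) • wordMonomial F (v * (u * w))))

/-- The two-sided ideal of the free nonassociative algebra generated by the relators. -/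
def superIdeal (F : Type*) [Field F] (X Y : Type*) :
    Submodule F (FreeNonUnitalNonAssocAlgebra F (X ⊕ Y)) :=
  sInf {I | (∀ r, IsSuperRelator F r → r ∈ I) ∧ ∀ a x, x ∈ I → a * x ∈ I ∧ x * a ∈ I}

theorem superIdeal_mul_left {F : Type*} [Field F] {X Y : Type*}
    (a : FreeNonUnitalNonAssocAlgebra F (X ⊕ Y)) {x : FreeNonUnitalNonAssocAlgebra F (X ⊕ Y)}
    (hx : x ∈ superIdeal F X Y) : a * x ∈ superIdeal F X Y :=
  Submodule.mem_sInf.2 fun I hI => (hI.2 a x (Submodule.mem_sInf.1 hx I hI)).1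

theorem superIdeal_mul_right {F : Type*} [Field F] {X Y : Type*}
    (a : FreeNonUnitalNonAssocAlgebra F (X ⊕ Y)) {x : FreeNonUnitalNonAssocAlgebra F (X ⊕ Y)}
    (hx : x ∈ superIdeal F X Y) : x * a ∈ superIdeal F X Y :=
  Submodule.mem_sInf.2 fun I hI => (hI.2 a x (Submodule.mem_sInf.1 hx I hI)).2

theorem superIdeal_of_relator {F : Type*} [Field F] {X Y : Type*}
    {r : FreeNonUnitalNonAssocAlgebra F (X ⊕ Y)} (hr : IsSuperRelator F r) :
    r ∈ superIdeal F X Y :=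
  Submodule.mem_sInf.2 fun _ hI => hI.1 r hr

/-- The free Lie superalgebra `ℒ(X, Y)` with even generators `X` and odd generators `Y`. -/
def FreeLieSuperalgebra (F : Type*) [Field F] (X Y : Type*) : Type _ :=
  FreeNonUnitalNonAssocAlgebra F (X ⊕ Y) ⧸ superIdeal F X Y

namespace FreeLieSuperalgebra

variable (F : Type*) [Field F] {X Y : Type*}

instance : AddCommGroup (FreeLieSuperalgebra F X Y) :=
  inferInstanceAs (AddCommGroup (_ ⧸ superIdeal F X Y))

instance : Module F (FreeLieSuperalgebra F X Y) :=
  inferInstanceAs (Module F (_ ⧸ superIdeal F X Y))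

/-- The quotient map. -/
def mk : FreeNonUnitalNonAssocAlgebra F (X ⊕ Y) →ₗ[F] FreeLieSuperalgebra F X Y :=
  (superIdeal F X Y).mkQ

variable {F}

theorem mk_surjective :
    Function.Surjective (mk F : _ →ₗ[F] FreeLieSuperalgebra F X Y) :=
  (superIdeal F X Y).mkQ_surjective

theorem mk_eq_mk {x y : FreeNonUnitalNonAssocAlgebra F (X ⊕ Y)} :
    mk F x = mk F y ↔ x - y ∈ superIdeal F X Y :=
  Submodule.Quotient.eq _

instance : Mul (FreeLieSuperalgebra F X Y) where
  mul := Quotient.map₂ (· * ·) fun a a' ha b b' hb => by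
    rw [← Quotient.eq_iff_equiv] at *
    have ha : a - a' ∈ superIdeal F X Y := (Submodule.Quotient.eq _).1 ha
    have hb : b - b' ∈ superIdeal F X Y := (Submodule.Quotient.eq _).1 hb
    refine (Submodule.Quotient.eq (superIdeal F X Y)).2 ?_
    have h : a * b - a' * b' = (a - a') * b + a' * (b - b') := by
      rw [sub_mul, mul_sub]; abel
    rw [h]
    exact add_mem (superIdeal_mul_right b ha) (superIdeal_mul_left a' hb)

theorem mk_mul (x y : FreeNonUnitalNonAssocAlgebra F (X ⊕ Y)) :
    mk F (x * y) = mk F x * mk F y := rfl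

instance : NonUnitalNonAssocRing (FreeLieSuperalgebra F X Y) :=
  { (inferInstance : AddCommGroup (FreeLieSuperalgebra F X Y)),
    (inferInstance : Mul (FreeLieSuperalgebra F X Y)) with
    left_distrib := fun a b c => by
      obtain ⟨a, rfl⟩ := mk_surjective a
      obtain ⟨b, rfl⟩ := mk_surjective b
      obtain ⟨c, rfl⟩ := mk_surjective c
      simp only [← mk_mul, ← map_add, mul_add]
    right_distrib := fun a b c => by
      obtain ⟨a, rfl⟩ := mk_surjective a
      obtain ⟨b, rfl⟩ := mk_surjective b
      obtain ⟨c, rfl⟩ := mk_surjective c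
      simp only [← mk_mul, ← map_add, add_mul]
    zero_mul := fun a => by
      obtain ⟨a, rfl⟩ := mk_surjective a
      rw [← map_zero (mk F), ← mk_mul, zero_mul]
    mul_zero := fun a => by
      obtain ⟨a, rfl⟩ := mk_surjective a
      rw [← map_zero (mk F), ← mk_mul, mul_zero] }

instance : IsScalarTower F (FreeLieSuperalgebra F X Y) (FreeLieSuperalgebra F X Y) where
  smul_assoc r a b := by
    obtain ⟨a, rfl⟩ := mk_surjective a
    obtain ⟨b, rfl⟩ := mk_surjective b
    simp only [smul_eq_mul, ← mk_mul, ← map_smul, smul_mul_assoc]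

instance : SMulCommClass F (FreeLieSuperalgebra F X Y) (FreeLieSuperalgebra F X Y) where
  smul_comm r a b := by
    obtain ⟨a, rfl⟩ := mk_surjective a
    obtain ⟨b, rfl⟩ := mk_surjective b
    simp only [smul_eq_mul, ← mk_mul, ← map_smul, mul_smul_comm]

section Eval

variable {A : Type*} [NonUnitalNonAssocRing A] [Module F A] [IsScalarTower F A A]
  [SMulCommClass F A A] (𝒜 : ZMod 2 → Submodule F A)

/-- Evaluation of a nonassociative polynomial at even elements `a` and odd elements `b`. -/
def preEval (a : X → 𝒜 0) (b : Y → 𝒜 1) :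
    FreeNonUnitalNonAssocAlgebra F (X ⊕ Y) →ₙₐ[F] A :=
  FreeNonUnitalNonAssocAlgebra.lift F (Sum.elim (fun x => (a x : A)) (fun y => (b y : A)))

theorem wordMonomial_mul (u v : FreeMagma (X ⊕ Y)) :
    wordMonomial F (u * v) = wordMonomial F u * wordMonomial F v :=
  map_mul (MonoidAlgebra.ofMagma F (FreeMagma (X ⊕ Y))) u v

theorem preEval_word_mem [IsLieSuperalgebra 𝒜] (a : X → 𝒜 0) (b : Y → 𝒜 1)
    (w : FreeMagma (X ⊕ Y)) : preEval 𝒜 a b (wordMonomial F w) ∈ 𝒜 (wordParity w) := by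
  induction w with
  | ih1 x =>
    have h : preEval 𝒜 a b (wordMonomial F (FreeMagma.of x))
        = Sum.elim (fun x => (a x : A)) (fun y => (b y : A)) x :=
      FreeNonUnitalNonAssocAlgebra.lift_of_apply F _ x
    rw [h]
    cases x with
    | inl x => exact (a x).2
    | inr y => exact (b y).2
  | ih2 u v hu hv =>
    rw [wordMonomial_mul, map_mul]
    exact IsLieSuperalgebra.mul_mem hu hv

theorem superIdeal_le_ker_preEval [IsLieSuperalgebra 𝒜] (a : X → 𝒜 0) (b : Y → 𝒜 1) :
    superIdeal F X Y ≤ LinearMap.ker (preEval 𝒜 a b : _ →ₗ[F] A) := by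
  refine sInf_le ⟨fun r hr => ?_, fun c x hx => ?_⟩
  · change preEval 𝒜 a b r = 0
    cases hr with
    | skew u v =>
      simp only [wordMonomial_mul, map_add, map_smul, map_mul]
      exact IsLieSuperalgebra.skew (preEval_word_mem 𝒜 a b u) (preEval_word_mem 𝒜 a b v)
    | jacobi u v w =>
      simp only [wordMonomial_mul, map_add, map_smul, map_mul, map_sub]
      exact sub_eq_zero.2 (IsLieSuperalgebra.jacobi (preEval_word_mem 𝒜 a b u)
        (preEval_word_mem 𝒜 a b v) (preEval_word_mem 𝒜 a b w))
  · have hx : preEval 𝒜 a b x = 0 := hx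
    constructor
    · change preEval 𝒜 a b (c * x) = 0
      rw [map_mul, hx, mul_zero]
    · change preEval 𝒜 a b (x * c) = 0
      rw [map_mul, hx, zero_mul]

/-- The value `f(a, b)` of `f ∈ ℒ(X, Y)` in a Lie superalgebra, where even generators are sent to
even elements `a` and odd generators to odd elements `b`. -/
def eval [IsLieSuperalgebra 𝒜] (a : X → 𝒜 0) (b : Y → 𝒜 1) :
    FreeLieSuperalgebra F X Y →ₗ[F] A :=
  (superIdeal F X Y).liftQ (preEval 𝒜 a b : _ →ₗ[F] A) (superIdeal_le_ker_preEval 𝒜 a b)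

theorem eval_mk [IsLieSuperalgebra 𝒜] (a : X → 𝒜 0) (b : Y → 𝒜 1)
    (f : FreeNonUnitalNonAssocAlgebra F (X ⊕ Y)) :
    eval 𝒜 a b (mk F f) = preEval 𝒜 a b f := rfl

theorem eval_mul [IsLieSuperalgebra 𝒜] (a : X → 𝒜 0) (b : Y → 𝒜 1)
    (f g : FreeLieSuperalgebra F X Y) :
    eval 𝒜 a b (f * g) = eval 𝒜 a b f * eval 𝒜 a b g := by
  obtain ⟨f, rfl⟩ := mk_surjective f
  obtain ⟨g, rfl⟩ := mk_surjective g
  rw [← mk_mul]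
  simp only [eval_mk, map_mul]

end Eval

end FreeLieSuperalgebra

/-! ### Graded identities and graded codimensions -/

/-- `P_{k,l}`: the multilinear polynomials in the even variables `x_0, …, x_{k-1}` and the odd
variables `y_0, …, y_{l-1}` of the free Lie superalgebra on countably many even and odd
generators. -/
def multilinearPart (F : Type*) [Field F] (k l : ℕ) :
    Submodule F (FreeLieSuperalgebra F ℕ ℕ) :=
  Submodule.span F ((fun w => FreeLieSuperalgebra.mk F (wordMonomial F w)) ''
    {w : FreeMagma (ℕ ⊕ ℕ) | wordLetters w =
      (Multiset.range k).map Sum.inl + (Multiset.range l).map Sum.inr})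

section Codimensions

variable {F A : Type*} [Field F] [NonUnitalNonAssocRing A] [Module F A]
  [IsScalarTower F A A] [SMulCommClass F A A] (𝒜 : ZMod 2 → Submodule F A) [IsLieSuperalgebra 𝒜]

/-- `Id^gr(A)`: the polynomials that vanish under every evaluation of the even variables in
`𝒜 0` and of the odd variables in `𝒜 1`. -/
def gradedIdentities : Submodule F (FreeLieSuperalgebra F ℕ ℕ) :=
  ⨅ (a : ℕ → 𝒜 0) (b : ℕ → 𝒜 1), LinearMap.ker (FreeLieSuperalgebra.eval 𝒜 a b)

/-- The graded codimension `c_{k,l}(A) = dim P_{k,l} / (P_{k,l} ∩ Id^gr(A))`. -/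
def partialCodim (k l : ℕ) : ℕ :=
  Module.finrank F (multilinearPart F k l ⧸
    (multilinearPart F k l ⊓ gradedIdentities 𝒜).submoduleOf (multilinearPart F k l))

/-- The total graded codimension `c_n^gr(A) = ∑_{k=0}^n (n choose k) c_{k,n-k}(A)`. -/
def gradedCodim (n : ℕ) : ℕ :=
  ∑ k ∈ Finset.range (n + 1), n.choose k * partialCodim 𝒜 k (n - k)

end Codimensions

/-! ### The Lie superalgebra `b(2)` -/

section B2

open Matrix

variable (F : Type*) [Field F]

/-- The matrices `(A, 0; 0, -Aᵗ)` with `A` a traceless `2 × 2` matrix. -/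
def b2Even : Submodule F (Matrix (Fin 2 ⊕ Fin 2) (Fin 2 ⊕ Fin 2) F) where
  carrier := {M | ∃ A : Matrix (Fin 2) (Fin 2) F, A.trace = 0 ∧ M = fromBlocks A 0 0 (-Aᵀ)}
  add_mem' := by
    rintro _ _ ⟨A, hA, rfl⟩ ⟨B, hB, rfl⟩
    exact ⟨A + B, by simp [hA, hB], by simp [fromBlocks_add, add_comm]⟩
  zero_mem' := ⟨0, by simp, by simp⟩
  smul_mem' := by
    rintro c _ ⟨A, hA, rfl⟩
    exact ⟨c • A, by simp [hA], by simp [fromBlocks_smul]⟩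

/-- The matrices `(0, B; C, 0)` with `B` symmetric and `C` skew-symmetric of size `2 × 2`. -/
def b2Odd : Submodule F (Matrix (Fin 2 ⊕ Fin 2) (Fin 2 ⊕ Fin 2) F) where
  carrier := {M | ∃ B C : Matrix (Fin 2) (Fin 2) F, Bᵀ = B ∧ Cᵀ = -C ∧ M = fromBlocks 0 B C 0}
  add_mem' := by
    rintro _ _ ⟨B, C, hB, hC, rfl⟩ ⟨B', C', hB', hC', rfl⟩
    exact ⟨B + B', C + C', by simp [hB, hB'], by simp [hC, hC', add_comm],
      by simp [fromBlocks_add]⟩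
  zero_mem' := ⟨0, 0, by simp, by simp, by simp⟩
  smul_mem' := by
    rintro c _ ⟨B, C, hB, hC, rfl⟩
    exact ⟨c • B, c • C, by simp [hB], by simp [hC], by simp [fromBlocks_smul]⟩

/-- The homogeneous components of `b(2)`, inside the `4 × 4` matrices. -/
def b2Homogeneous (i : ZMod 2) : Submodule F (Matrix (Fin 2 ⊕ Fin 2) (Fin 2 ⊕ Fin 2) F) :=
  if i = 0 then b2Even F else b2Odd F

/-- The underlying vector space `L₀ ⊕ L₁` of `b(2)`, inside the `4 × 4` matrices. -/
def b2 : Submodule F (Matrix (Fin 2 ⊕ Fin 2) (Fin 2 ⊕ Fin 2) F) := b2Even F ⊔ b2Odd F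

variable {F}

/-- The block diagonal part of a matrix. -/
def evenPart (M : Matrix (Fin 2 ⊕ Fin 2) (Fin 2 ⊕ Fin 2) F) :
    Matrix (Fin 2 ⊕ Fin 2) (Fin 2 ⊕ Fin 2) F :=
  fromBlocks M.toBlocks₁₁ 0 0 M.toBlocks₂₂

/-- The block antidiagonal part of a matrix. -/
def oddPart (M : Matrix (Fin 2 ⊕ Fin 2) (Fin 2 ⊕ Fin 2) F) :
    Matrix (Fin 2 ⊕ Fin 2) (Fin 2 ⊕ Fin 2) F :=
  fromBlocks 0 M.toBlocks₁₂ M.toBlocks₂₁ 0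

/-- The super-Lie product on matrices: the bilinear extension of
`{x, y} = x y - (-1)^(|x||y|) y x` for homogeneous `x`, `y`. -/
def superBracket (x y : Matrix (Fin 2 ⊕ Fin 2) (Fin 2 ⊕ Fin 2) F) :
    Matrix (Fin 2 ⊕ Fin 2) (Fin 2 ⊕ Fin 2) F :=
  x * y - (evenPart y * evenPart x + evenPart y * oddPart x + oddPart y * evenPart x
    - oddPart y * oddPart x)

theorem evenPart_add (x y : Matrix (Fin 2 ⊕ Fin 2) (Fin 2 ⊕ Fin 2) F) :
    evenPart (x + y) = evenPart x + evenPart y := by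
  ext (i | i) (j | j) <;> simp [evenPart, toBlocks₁₁, toBlocks₂₂]

theorem oddPart_add (x y : Matrix (Fin 2 ⊕ Fin 2) (Fin 2 ⊕ Fin 2) F) :
    oddPart (x + y) = oddPart x + oddPart y := by
  ext (i | i) (j | j) <;> simp [oddPart, toBlocks₁₂, toBlocks₂₁]

theorem evenPart_smul (c : F) (x : Matrix (Fin 2 ⊕ Fin 2) (Fin 2 ⊕ Fin 2) F) :
    evenPart (c • x) = c • evenPart x := by
  ext (i | i) (j | j) <;> simp [evenPart, toBlocks₁₁, toBlocks₂₂]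

theorem oddPart_smul (c : F) (x : Matrix (Fin 2 ⊕ Fin 2) (Fin 2 ⊕ Fin 2) F) :
    oddPart (c • x) = c • oddPart x := by
  ext (i | i) (j | j) <;> simp [oddPart, toBlocks₁₂, toBlocks₂₁]

theorem superBracket_add (x y z : Matrix (Fin 2 ⊕ Fin 2) (Fin 2 ⊕ Fin 2) F) :
    superBracket x (y + z) = superBracket x y + superBracket x z := by
  simp only [superBracket, evenPart_add, oddPart_add]; noncomm_ring

theorem add_superBracket (x y z : Matrix (Fin 2 ⊕ Fin 2) (Fin 2 ⊕ Fin 2) F) :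
    superBracket (x + y) z = superBracket x z + superBracket y z := by
  simp only [superBracket, evenPart_add, oddPart_add]; noncomm_ring

theorem superBracket_smul (c : F) (x y : Matrix (Fin 2 ⊕ Fin 2) (Fin 2 ⊕ Fin 2) F) :
    superBracket x (c • y) = c • superBracket x y := by
  simp only [superBracket, evenPart_smul, oddPart_smul, mul_smul_comm, smul_mul_assoc, smul_sub,
    smul_add]

theorem smul_superBracket (c : F) (x y : Matrix (Fin 2 ⊕ Fin 2) (Fin 2 ⊕ Fin 2) F) :
    superBracket (c • x) y = c • superBracket x y := by
  simp only [superBracket, evenPart_smul, oddPart_smul, mul_smul_comm, smul_mul_assoc, smul_sub,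
    smul_add]

theorem parts_of_mem_b2Even {x : Matrix (Fin 2 ⊕ Fin 2) (Fin 2 ⊕ Fin 2) F} (hx : x ∈ b2Even F) :
    evenPart x = x ∧ oddPart x = 0 := by
  obtain ⟨A, -, rfl⟩ := hx
  simp [evenPart, oddPart]

theorem parts_of_mem_b2Odd {x : Matrix (Fin 2 ⊕ Fin 2) (Fin 2 ⊕ Fin 2) F} (hx : x ∈ b2Odd F) :
    evenPart x = 0 ∧ oddPart x = x := by
  obtain ⟨B, C, -, -, rfl⟩ := hx
  simp [evenPart, oddPart]

theorem parity_cases (i : ZMod 2) : i = 0 ∨ i = 1 := by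
  revert i; decide

/-- On homogeneous elements the product is the usual supercommutator. -/
theorem superBracket_of_mem {i j : ZMod 2} {x y : Matrix (Fin 2 ⊕ Fin 2) (Fin 2 ⊕ Fin 2) F}
    (hx : x ∈ b2Homogeneous F i) (hy : y ∈ b2Homogeneous F j) :
    superBracket x y = x * y - (-1 : F) ^ (i.val * j.val) • (y * x) := by
  rcases parity_cases i with rfl | rfl <;> rcases parity_cases j with rfl | rfl <;>
    simp only [b2Homogeneous, if_true, one_ne_zero, if_false] at hx hy
  · simp [superBracket, parts_of_mem_b2Even hx, parts_of_mem_b2Even hy]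
  · simp [superBracket, parts_of_mem_b2Even hx, parts_of_mem_b2Odd hy]
  · simp [superBracket, parts_of_mem_b2Odd hx, parts_of_mem_b2Even hy]
  · simp [superBracket, parts_of_mem_b2Odd hx, parts_of_mem_b2Odd hy, ZMod.val_one]

theorem trace_symm_mul_skew [CharZero F] {B C : Matrix (Fin 2) (Fin 2) F} (hB : Bᵀ = B)
    (hC : Cᵀ = -C) : (B * C).trace = 0 := by
  have h : (B * C).trace = -(B * C).trace := by
    conv_lhs => rw [← trace_transpose, transpose_mul, hB, hC, neg_mul, trace_neg, trace_mul_comm]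
  exact self_eq_neg.1 h

theorem superBracket_mem_homogeneous [CharZero F] {i j : ZMod 2}
    {x y : Matrix (Fin 2 ⊕ Fin 2) (Fin 2 ⊕ Fin 2) F}
    (hx : x ∈ b2Homogeneous F i) (hy : y ∈ b2Homogeneous F j) :
    superBracket x y ∈ b2Homogeneous F (i + j) := by
  rw [superBracket_of_mem hx hy]
  have h2 : (1 + 1 : ZMod 2) = 0 := by decide
  rcases parity_cases i with rfl | rfl <;> rcases parity_cases j with rfl | rfl <;>
    simp only [b2Homogeneous, if_true, one_ne_zero, if_false, add_zero, zero_add, h2] at hx hy ⊢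
  · obtain ⟨A, hA, rfl⟩ := hx
    obtain ⟨A', hA', rfl⟩ := hy
    refine ⟨A * A' - A' * A, by simp [trace_mul_comm A A'], ?_⟩
    simp [fromBlocks_multiply, sub_eq_add_neg, fromBlocks_neg, fromBlocks_add, add_comm]
  · obtain ⟨A, hA, rfl⟩ := hx
    obtain ⟨B, C, hB, hC, rfl⟩ := hy
    refine ⟨A * B + B * Aᵀ, -(Aᵀ * C) - C * A, ?_, ?_, ?_⟩
    · simp [hB, add_comm]
    · simp [hC]
    · simp [fromBlocks_multiply, sub_eq_add_neg, fromBlocks_neg, fromBlocks_add]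
  · obtain ⟨B, C, hB, hC, rfl⟩ := hx
    obtain ⟨A, hA, rfl⟩ := hy
    refine ⟨-(B * Aᵀ) - A * B, C * A + Aᵀ * C, ?_, ?_, ?_⟩
    · simp [hB]; abel
    · simp [hC]
    · simp [fromBlocks_multiply, sub_eq_add_neg, fromBlocks_neg, fromBlocks_add]
  · obtain ⟨B, C, hB, hC, rfl⟩ := hx
    obtain ⟨B', C', hB', hC', rfl⟩ := hy
    refine ⟨B * C' + B' * C, ?_, ?_⟩
    · rw [trace_add, trace_symm_mul_skew hB hC', trace_symm_mul_skew hB' hC, add_zero]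
    · simp [fromBlocks_multiply, fromBlocks_add, hB, hB', hC, hC', ZMod.val_one, add_comm]

theorem b2Homogeneous_le (i : ZMod 2) : b2Homogeneous F i ≤ b2 F := by
  rcases parity_cases i with rfl | rfl
  · exact le_sup_left
  · exact le_sup_right

theorem superBracket_mem [CharZero F] {x y : Matrix (Fin 2 ⊕ Fin 2) (Fin 2 ⊕ Fin 2) F}
    (hx : x ∈ b2 F) (hy : y ∈ b2 F) : superBracket x y ∈ b2 F := by
  obtain ⟨x₀, hx₀, x₁, hx₁, rfl⟩ := Submodule.mem_sup.1 hx
  obtain ⟨y₀, hy₀, y₁, hy₁, rfl⟩ := Submodule.mem_sup.1 hy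
  have h (i j : ZMod 2) {u v : Matrix (Fin 2 ⊕ Fin 2) (Fin 2 ⊕ Fin 2) F}
      (hu : u ∈ b2Homogeneous F i) (hv : v ∈ b2Homogeneous F j) : superBracket u v ∈ b2 F :=
    b2Homogeneous_le _ (superBracket_mem_homogeneous hu hv)
  rw [superBracket_add, add_superBracket, add_superBracket]
  exact add_mem (add_mem (h 0 0 hx₀ hy₀) (h 1 0 hx₁ hy₀)) (add_mem (h 0 1 hx₀ hy₁) (h 1 1 hx₁ hy₁))

/-- `b(2)` with the super-Lie product as its multiplication. -/
instance [CharZero F] : NonUnitalNonAssocRing (b2 F) :=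
  { (inferInstance : AddCommGroup (b2 F)) with
    mul := fun x y => ⟨superBracket x.1 y.1, superBracket_mem x.2 y.2⟩
    left_distrib := fun x y z => Subtype.ext (superBracket_add x.1 y.1 z.1)
    right_distrib := fun x y z => Subtype.ext (add_superBracket x.1 y.1 z.1)
    zero_mul := fun x => Subtype.ext (by
      have h := smul_superBracket (0 : F) 0 x.1
      rwa [zero_smul, zero_smul] at h)
    mul_zero := fun x => Subtype.ext (by
      have h := superBracket_smul (0 : F) x.1 0
      rwa [zero_smul, zero_smul] at h) }

theorem b2_coe_mul [CharZero F] (x y : b2 F) :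
    ((x * y : b2 F) : Matrix (Fin 2 ⊕ Fin 2) (Fin 2 ⊕ Fin 2) F) = superBracket x.1 y.1 := rfl

instance [CharZero F] : IsScalarTower F (b2 F) (b2 F) where
  smul_assoc r a b := Subtype.ext (smul_superBracket r a.1 b.1)

instance [CharZero F] : SMulCommClass F (b2 F) (b2 F) where
  smul_comm r a b := Subtype.ext (superBracket_smul r a.1 b.1).symm

variable (F) in
/-- The `ℤ/2`-grading `b(2) = L₀ ⊕ L₁`. -/
def b2Grading (i : ZMod 2) : Submodule F (b2 F) := (b2Homogeneous F i).submoduleOf (b2 F)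

theorem mem_b2Grading {i : ZMod 2} {x : b2 F} :
    x ∈ b2Grading F i ↔ x.1 ∈ b2Homogeneous F i := Iff.rfl

/-- `b(2)` is a Lie superalgebra. -/
instance [CharZero F] : IsLieSuperalgebra (b2Grading F) where
  isInternal := by
    rw [DirectSum.isInternal_submodule_iff_isCompl (b2Grading F) (i := 0) (j := 1) (by decide)
      (by ext i; simpa using parity_cases i)]
    constructor
    · rw [Submodule.disjoint_def]
      intro x hx hy
      have h0 := (parts_of_mem_b2Even (F := F) (x := x.1) hx).1
      have h1 := (parts_of_mem_b2Odd (F := F) (x := x.1) hy).1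
      exact Subtype.ext (h0.symm.trans h1)
    · rw [codisjoint_iff, eq_top_iff]
      rintro ⟨x, hx⟩ -
      obtain ⟨x₀, hx₀, x₁, hx₁, rfl⟩ := Submodule.mem_sup.1 hx
      exact Submodule.mem_sup.2 ⟨⟨x₀, b2Homogeneous_le 0 hx₀⟩, hx₀,
        ⟨x₁, b2Homogeneous_le 1 hx₁⟩, hx₁, rfl⟩
  mul_mem hx hy := superBracket_mem_homogeneous hx hy
  skew {i j x y} hx hy := by
    apply Subtype.ext
    simp only [Submodule.coe_add, Submodule.coe_smul, b2_coe_mul, Submodule.coe_zero]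
    replace hx : x.1 ∈ b2Homogeneous F i := hx
    replace hy : y.1 ∈ b2Homogeneous F j := hy
    rw [superBracket_of_mem hx hy, superBracket_of_mem hy hx]
    rcases parity_cases i with rfl | rfl <;> rcases parity_cases j with rfl | rfl <;>
      simp [ZMod.val_one]
  jacobi {i j k x y z} hx hy hz := by
    apply Subtype.ext
    simp only [Submodule.coe_add, Submodule.coe_smul, b2_coe_mul]
    replace hx : x.1 ∈ b2Homogeneous F i := hx
    replace hy : y.1 ∈ b2Homogeneous F j := hy
    replace hz : z.1 ∈ b2Homogeneous F k := hz
    rw [superBracket_of_mem hx (superBracket_mem_homogeneous hy hz),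
      superBracket_of_mem (superBracket_mem_homogeneous hx hy) hz,
      superBracket_of_mem hy (superBracket_mem_homogeneous hx hz),
      superBracket_of_mem hy hz, superBracket_of_mem hx hy, superBracket_of_mem hx hz]
    have h2 : (1 + 1 : ZMod 2) = 0 := by decide
    rcases parity_cases i with rfl | rfl <;> rcases parity_cases j with rfl | rfl <;>
      rcases parity_cases k with rfl | rfl <;>
      simp [ZMod.val_one, h2] <;> noncomm_ring

end B2

end

/-! The even part of `b(2)` is `sl₂`. Multiplying the symmetric upper block by the standard skew
matrix identifies it with the adjoint module, so two odd elements applied in succession to an even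
element act as `ad` of an element of `sl₂`: the second supplies a vector, the first a scalar
(`b2O_mul_b2O_mul_b2E`). The standard polynomial of degree three in such operators is a scalar,
namely a multiple of the determinant (`slBracket_standard`).

Take `k + 1` even and `2r` odd generators with `k + r = 3p`. Choose which `r` odd generators supply
scalars and pair them with the others; with `k` even generators this gives `3p` operators. Fill them
into a standard tableau of shape `(p, p, p)` and apply the product of the standard polynomials of
its columns to the remaining even generator. Evaluating vectors at basis elements and scalars at 0
or 1 separates these polynomials: different choices of the `r` generators give 0, and for one choice
the evaluation matrix is triangular in the lexicographic order of row words (`IsTableau.toLex_le`).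
Hence `choose_mul_tableauCount_le_partialCodim`.

That bound is about `4^r * 27^p` up to a power of `n`. Since `3 * 27^p * 4^r = 3^(k+1) *
(2√3)^(2r)`, multiplying by the binomial coefficient gives a term of the expansion of `(3 + 2√3)^n`.
Admissible indices form one residue class modulo 6, and neighbouring terms differ by a factor of at
most `2n`, so every term, and then the sum, is controlled at polynomial cost. -/

noncomputable section

/-! ### Words with prescribed letters -/

theorem wordLetters_ne_zero {α : Type*} (w : FreeMagma α) : wordLetters w ≠ 0 := by
  induction w with
  | ih1 a => exact Multiset.singleton_ne_zero a
  | ih2 u v hu hv =>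
    intro h
    exact hu (add_eq_zero.1 (show wordLetters u + wordLetters v = 0 from h)).1

/-- A word is a letter or a product of two words whose nonempty letter multisets split `μ`, and
there are finitely many splittings. This makes the multilinear parts finite dimensional, without
which `finrank` could not bound independent families. -/
theorem finite_setOf_wordLetters_eq {α : Type*} (μ : Multiset α) :
    {w : FreeMagma α | wordLetters w = μ}.Finite := by
  induction hn : Multiset.card μ using Nat.strong_induction_on generalizing μ with
  | _ n ih =>
    classical
    let pairs : Finset (Multiset α × Multiset α) :=
      μ.antidiagonal.toFinset.filter fun p => p.1 ≠ 0 ∧ p.2 ≠ 0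
    have hfin : (⋃ p ∈ pairs, Set.image2 (fun u v : FreeMagma α => u * v)
        {w | wordLetters w = p.1} {w | wordLetters w = p.2}).Finite := by
      refine Set.Finite.biUnion pairs.finite_toSet fun p hp => ?_
      have hp' := (Finset.mem_filter.1 hp)
      have hadd : p.1 + p.2 = μ := Multiset.mem_antidiagonal.1 (Multiset.mem_toFinset.1 hp'.1)
      have h1 := Multiset.card_pos.2 hp'.2.1
      have h2 := Multiset.card_pos.2 hp'.2.2
      have h3 : Multiset.card p.1 + Multiset.card p.2 = n := by
        rw [← Multiset.card_add, hadd, hn]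
      exact Set.Finite.image2 _ (ih _ (by omega) p.1 rfl) (ih _ (by omega) p.2 rfl)
    refine (((μ.toFinset.finite_toSet).image FreeMagma.of).union hfin).subset ?_
    intro w hw
    cases w with
    | of a =>
      refine Or.inl ⟨a, ?_, rfl⟩
      have h : ({a} : Multiset α) = μ := hw
      simp [← h]
    | mul u v =>
      refine Or.inr (Set.mem_biUnion (x := (wordLetters u, wordLetters v)) ?_
        ⟨u, rfl, v, rfl, rfl⟩)
      refine Finset.mem_filter.2 ⟨Multiset.mem_toFinset.2 (Multiset.mem_antidiagonal.2 hw),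
        wordLetters_ne_zero u, wordLetters_ne_zero v⟩

namespace FreeLieSuperalgebra

variable (F : Type*) [Field F]

/-- The span of the words with a given multiset of letters. -/
def wordSpan {X Y : Type*} (μ : Multiset (X ⊕ Y)) : Submodule F (FreeLieSuperalgebra F X Y) :=
  Submodule.span F ((fun w => mk F (wordMonomial F w)) '' {w | wordLetters w = μ})

instance {X Y : Type*} (μ : Multiset (X ⊕ Y)) : FiniteDimensional F (wordSpan F μ) :=
  FiniteDimensional.span_of_finite F ((finite_setOf_wordLetters_eq μ).image _)

/-- The generator attached to a letter. -/
def letter {X Y : Type*} (a : X ⊕ Y) : FreeLieSuperalgebra F X Y :=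
  mk F (wordMonomial F (FreeMagma.of a))

variable {F}

theorem letter_mem_wordSpan {X Y : Type*} (a : X ⊕ Y) : letter F a ∈ wordSpan F {a} :=
  Submodule.subset_span ⟨FreeMagma.of a, rfl, rfl⟩

theorem letter_mul_mem_wordSpan {X Y : Type*} (a : X ⊕ Y) {μ : Multiset (X ⊕ Y)}
    {f : FreeLieSuperalgebra F X Y} (hf : f ∈ wordSpan F μ) :
    letter F a * f ∈ wordSpan F ({a} + μ) := by
  have h : wordSpan F μ ≤ (wordSpan F ({a} + μ)).comap (LinearMap.mulLeft F (letter F a)) := by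
    refine Submodule.span_le.2 ?_
    rintro _ ⟨w, hw, rfl⟩
    refine Submodule.subset_span ⟨FreeMagma.of a * w, ?_, ?_⟩
    · exact congrArg (fun t => {a} + t) (show wordLetters w = μ from hw)
    · simp only [wordMonomial_mul, mk_mul, LinearMap.mulLeft_apply]
      rfl
  exact h hf

theorem eval_letter_inl {X Y A : Type*} [NonUnitalNonAssocRing A] [Module F A]
    [IsScalarTower F A A] [SMulCommClass F A A] (𝒜 : ZMod 2 → Submodule F A)
    [IsLieSuperalgebra 𝒜] (a : X → 𝒜 0) (b : Y → 𝒜 1) (i : X) :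
    eval 𝒜 a b (letter F (Sum.inl i)) = a i :=
  FreeNonUnitalNonAssocAlgebra.lift_of_apply F _ _

theorem eval_letter_inr {X Y A : Type*} [NonUnitalNonAssocRing A] [Module F A]
    [IsScalarTower F A A] [SMulCommClass F A A] (𝒜 : ZMod 2 → Submodule F A)
    [IsLieSuperalgebra 𝒜] (a : X → 𝒜 0) (b : Y → 𝒜 1) (j : Y) :
    eval 𝒜 a b (letter F (Sum.inr j)) = b j :=
  FreeNonUnitalNonAssocAlgebra.lift_of_apply F _ _

end FreeLieSuperalgebra

/-! ### Lower bounds from triangular evaluations -/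

open FreeLieSuperalgebra

/-- Multilinear polynomials that are separated by as many evaluations, in the triangular sense,
bound the graded codimension from below. -/
theorem card_le_partialCodim {F A : Type*} [Field F] [NonUnitalNonAssocRing A] [Module F A]
    [IsScalarTower F A A] [SMulCommClass F A A] (𝒜 : ZMod 2 → Submodule F A)
    [IsLieSuperalgebra 𝒜] {k l : ℕ} {ι κ : Type*} [Fintype ι] [LinearOrder κ] (key : ι → κ)
    (f : ι → FreeLieSuperalgebra F ℕ ℕ) (hf : ∀ i, f i ∈ multilinearPart F k l)
    (a : ι → ℕ → 𝒜 0) (b : ι → ℕ → 𝒜 1) (φ : A →ₗ[F] F)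
    (hdiag : ∀ i, φ (eval 𝒜 (a i) (b i) (f i)) ≠ 0)
    (htri : ∀ i j, φ (eval 𝒜 (a i) (b i) (f j)) ≠ 0 → i = j ∨ key j < key i) :
    Fintype.card ι ≤ partialCodim 𝒜 k l := by
  classical
  let Φ : FreeLieSuperalgebra F ℕ ℕ →ₗ[F] (ι → F) :=
    LinearMap.pi fun i => φ ∘ₗ eval 𝒜 (a i) (b i)
  have hΦ : LinearIndependent F fun j => Φ (f j) := by
    rw [Fintype.linearIndependent_iff]
    intro c hc
    by_contra! hne
    obtain ⟨i₀, hi₀⟩ := hne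
    -- At the point of minimal key among nonzero coefficients, every other surviving polynomial
    -- would need a still smaller key, so only the diagonal term remains.
    obtain ⟨i, hi, hmin⟩ := (Finset.univ.filter fun i => c i ≠ 0).exists_min_image key
      ⟨i₀, by simpa using hi₀⟩
    have hval := congrFun hc i
    simp only [Finset.sum_apply, Pi.smul_apply, smul_eq_mul, Pi.zero_apply] at hval
    rw [Finset.sum_eq_single i] at hval
    · exact (mul_ne_zero (Finset.mem_filter.1 hi).2 (hdiag i)) hval
    · intro j _ hji
      by_contra hprod
      have hcj := left_ne_zero_of_mul hprod
      rcases htri i j (right_ne_zero_of_mul hprod) with h | h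
      · exact hji h.symm
      · exact absurd (hmin j (by simpa using hcj)) (not_le.2 h)
    · simp
  have hker : gradedIdentities 𝒜 ≤ LinearMap.ker Φ := by
    intro g hg
    ext i
    have hg' : eval 𝒜 (a i) (b i) g = 0 :=
      (Submodule.mem_iInf _).1 ((Submodule.mem_iInf _).1 hg (a i)) (b i)
    simp [Φ, hg']
  let P := multilinearPart F k l
  let N := (P ⊓ gradedIdentities 𝒜).submoduleOf P
  have hle : N ≤ LinearMap.ker (Φ.domRestrict P) := fun g hg => hker hg.2
  let Ψ : (P ⧸ N) →ₗ[F] (ι → F) := N.liftQ (Φ.domRestrict P) hle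
  have : FiniteDimensional F P :=
    inferInstanceAs (FiniteDimensional F (wordSpan F _))
  have hli : LinearIndependent F fun j => N.mkQ ⟨f j, hf j⟩ :=
    LinearIndependent.of_comp Ψ hΦ
  exact hli.fintype_card_le_finrank

/-! ### Coordinates on `b(2)` -/

section Model

open Matrix

variable {F : Type*} [Field F]

/-- The bracket of `sl₂` in coordinates with respect to the basis `e, h, f`. -/
def slBracket (u v : Fin 3 → F) : Fin 3 → F :=
  ![2 * (u 1 * v 0 - u 0 * v 1), u 0 * v 2 - u 2 * v 0, 2 * (u 2 * v 1 - u 1 * v 2)]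

/-- The determinant of three vectors. -/
def tripleDet (u v w : Fin 3 → F) : F :=
  u 0 * (v 1 * w 2 - v 2 * w 1) - u 1 * (v 0 * w 2 - v 2 * w 0) + u 2 * (v 0 * w 1 - v 1 * w 0)

/-- The standard polynomial of degree three acts on the adjoint module of `sl₂` by a multiple of
the determinant. -/
theorem slBracket_standard (u v w z : Fin 3 → F) :
    slBracket u (slBracket v (slBracket w z)) - slBracket u (slBracket w (slBracket v z))
      + slBracket v (slBracket w (slBracket u z)) - slBracket v (slBracket u (slBracket w z))
      + slBracket w (slBracket u (slBracket v z)) - slBracket w (slBracket v (slBracket u z))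
      = (-8 * tripleDet u v w) • z := by
  ext i
  fin_cases i <;> simp [slBracket, tripleDet] <;> ring

theorem slBracket_smul (c : F) (u v : Fin 3 → F) :
    slBracket (c • u) v = c • slBracket u v := by
  ext i
  fin_cases i <;> simp [slBracket] <;> ring

theorem fromBlocks_mem_b2Even (v : Fin 3 → F) :
    fromBlocks !![v 1, v 0; v 2, -v 1] 0 0 !![-v 1, -v 2; -v 0, v 1] ∈ b2Even F :=
  ⟨!![v 1, v 0; v 2, -v 1], by simp [trace_fin_two], by
    ext (i | i) (j | j) <;> fin_cases i <;> fin_cases j <;> simp⟩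

theorem fromBlocks_mem_b2Odd (v : Fin 3 → F) (α : F) :
    fromBlocks 0 !![v 0, -v 1; -v 1, -v 2] !![0, α; -α, 0] 0 ∈ b2Odd F :=
  ⟨_, _, by ext i j; fin_cases i <;> fin_cases j <;> simp,
    by ext i j; fin_cases i <;> fin_cases j <;> simp, rfl⟩

/-- The even element of `b(2)` with given coordinates. -/
def b2E (v : Fin 3 → F) : b2 F :=
  ⟨fromBlocks !![v 1, v 0; v 2, -v 1] 0 0 !![-v 1, -v 2; -v 0, v 1],
    b2Homogeneous_le 0 (fromBlocks_mem_b2Even v)⟩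

/-- The odd element of `b(2)` with symmetric upper right block of given coordinates, and lower left
block `α` times the standard skew-symmetric matrix. -/
def b2O (v : Fin 3 → F) (α : F) : b2 F :=
  ⟨fromBlocks 0 !![v 0, -v 1; -v 1, -v 2] !![0, α; -α, 0] 0,
    b2Homogeneous_le 1 (fromBlocks_mem_b2Odd v α)⟩

theorem b2E_mem (v : Fin 3 → F) : b2E v ∈ b2Grading F 0 :=
  fromBlocks_mem_b2Even v

theorem b2O_mem (v : Fin 3 → F) (α : F) : b2O v α ∈ b2Grading F 1 :=
  fromBlocks_mem_b2Odd v α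

theorem b2E_add (u v : Fin 3 → F) : b2E (u + v) = b2E u + b2E v := by
  apply Subtype.ext
  ext (i | i) (j | j) <;> fin_cases i <;> fin_cases j <;> simp [b2E] <;> ring

theorem b2E_neg (u : Fin 3 → F) : b2E (-u) = -b2E u := by
  apply Subtype.ext
  ext (i | i) (j | j) <;> fin_cases i <;> fin_cases j <;> simp [b2E]

theorem b2E_sub (u v : Fin 3 → F) : b2E (u - v) = b2E u - b2E v := by
  rw [sub_eq_add_neg, b2E_add, b2E_neg, ← sub_eq_add_neg]

variable (F) in
/-- The coordinate of `e` in an element of `b(2)`. -/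
def coordE : b2 F →ₗ[F] F where
  toFun x := x.1 (Sum.inl 0) (Sum.inl 1)
  map_add' _ _ := rfl
  map_smul' _ _ := rfl

theorem coordE_b2E (v : Fin 3 → F) : coordE F (b2E v) = v 0 := rfl

variable [CharZero F]

theorem b2E_mul_b2E (u v : Fin 3 → F) : b2E u * b2E v = b2E (slBracket u v) := by
  apply Subtype.ext
  rw [b2_coe_mul]
  ext (i | i) (j | j) <;> fin_cases i <;> fin_cases j <;>
    simp [superBracket, evenPart, oddPart, b2E, slBracket, fromBlocks_multiply] <;> ring

/-- The lower block drops out because traceless matrices act trivially on the one-dimensional space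
of skew forms; the upper block carries the adjoint module. -/
theorem b2O_mul_b2E (u v : Fin 3 → F) (α : F) : b2O u α * b2E v = b2O (slBracket u v) 0 := by
  apply Subtype.ext
  rw [b2_coe_mul]
  ext (i | i) (j | j) <;> fin_cases i <;> fin_cases j <;>
    simp [superBracket, evenPart, oddPart, b2E, b2O, slBracket, fromBlocks_multiply] <;> ring

theorem b2O_mul_b2O_zero (u v : Fin 3 → F) (α : F) : b2O u α * b2O v 0 = b2E (α • v) := by
  apply Subtype.ext
  rw [b2_coe_mul]
  ext (i | i) (j | j) <;> fin_cases i <;> fin_cases j <;>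
    simp [superBracket, evenPart, oddPart, b2E, b2O, fromBlocks_multiply] <;> ring

/-- Two odd elements act on even ones like one even element. The roles are asymmetric: only the
scalar of the outer factor and the vector of the inner factor survive, which lets evaluations detect
which odd generators stand outside. -/
theorem b2O_mul_b2O_mul_b2E (u v z : Fin 3 → F) (α β : F) :
    b2O u α * (b2O v β * b2E z) = b2E (slBracket (α • v) z) := by
  rw [b2O_mul_b2E, b2O_mul_b2O_zero, slBracket_smul]

end Model

/-! ### Operators on the free Lie superalgebra -/

section Operators

variable (F : Type*) [Field F]

/-- Left multiplication by an even generator, or by two odd generators in succession. -/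
def adjOp : ℕ ⊕ ℕ × ℕ → Module.End F (FreeLieSuperalgebra F ℕ ℕ)
  | .inl i => LinearMap.mulLeft F (letter F (.inl i))
  | .inr (i, j) =>
    LinearMap.mulLeft F (letter F (.inr i)) * LinearMap.mulLeft F (letter F (.inr j))

/-- The generators involved in `adjOp`. -/
def adjLetters : ℕ ⊕ ℕ × ℕ → Multiset (ℕ ⊕ ℕ)
  | .inl i => {.inl i}
  | .inr (i, j) => {.inr i} + {.inr j}

variable {F}

theorem adjOp_mem_wordSpan (t : ℕ ⊕ ℕ × ℕ) {μ : Multiset (ℕ ⊕ ℕ)}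
    {f : FreeLieSuperalgebra F ℕ ℕ} (hf : f ∈ wordSpan F μ) :
    adjOp F t f ∈ wordSpan F (adjLetters t + μ) := by
  rcases t with i | ⟨i, j⟩
  · exact letter_mul_mem_wordSpan _ hf
  · have h := letter_mul_mem_wordSpan (.inr i) (letter_mul_mem_wordSpan (.inr j) hf)
    rwa [← add_assoc] at h

/-- The standard polynomial of degree three in operators. -/
def standardOp {M : Type*} [AddCommGroup M] [Module F M] (A B C : Module.End F M) :
    Module.End F M :=
  A * B * C - A * C * B + B * C * A - B * A * C + C * A * B - C * B * A

theorem standardOp_mem_wordSpan (s t u : ℕ ⊕ ℕ × ℕ) {μ : Multiset (ℕ ⊕ ℕ)}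
    {f : FreeLieSuperalgebra F ℕ ℕ} (hf : f ∈ wordSpan F μ) :
    standardOp (adjOp F s) (adjOp F t) (adjOp F u) f ∈
      wordSpan F (adjLetters s + adjLetters t + adjLetters u + μ) := by
  have h : ∀ a b c : ℕ ⊕ ℕ × ℕ, adjLetters s + adjLetters t + adjLetters u + μ =
      adjLetters a + (adjLetters b + (adjLetters c + μ)) →
      adjOp F a (adjOp F b (adjOp F c f)) ∈
        wordSpan F (adjLetters s + adjLetters t + adjLetters u + μ) := by
    intro a b c e
    rw [e]
    exact adjOp_mem_wordSpan a (adjOp_mem_wordSpan b (adjOp_mem_wordSpan c hf))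
  refine sub_mem (add_mem (sub_mem (add_mem (sub_mem ?_ ?_) ?_) ?_) ?_) ?_ <;>
    exact h _ _ _ (by abel)

/-- The product of the standard polynomials of the columns of a rectangular array, applied to an
even generator. -/
def columnsPoly (F : Type*) [Field F] (T : ℕ → ℕ ⊕ ℕ × ℕ) (C : Fin 3 → ℕ → ℕ) (z : ℕ) :
    ℕ → FreeLieSuperalgebra F ℕ ℕ
  | 0 => letter F (.inl z)
  | p + 1 => standardOp (adjOp F (T (C 0 p))) (adjOp F (T (C 1 p))) (adjOp F (T (C 2 p)))
      (columnsPoly F T C z p)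

theorem columnsPoly_mem_wordSpan (T : ℕ → ℕ ⊕ ℕ × ℕ) (C : Fin 3 → ℕ → ℕ) (z p : ℕ) :
    columnsPoly F T C z p ∈
      wordSpan F (∑ i ∈ Finset.range p, ∑ c : Fin 3, adjLetters (T (C c i)) + {.inl z}) := by
  induction p with
  | zero => simpa [columnsPoly] using letter_mem_wordSpan (F := F) (Y := ℕ) (.inl z)
  | succ p ih =>
    have h := standardOp_mem_wordSpan (T (C 0 p)) (T (C 1 p)) (T (C 2 p)) ih
    rw [Finset.sum_range_succ, Fin.sum_univ_three, columnsPoly]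
    convert h using 2
    abel

/-- The even elements of `b(2)` with given coordinates, as values of even generators. -/
def evenPoint (a : ℕ → Fin 3 → F) (i : ℕ) : b2Grading F 0 := ⟨b2E (a i), b2E_mem _⟩

/-- The odd elements of `b(2)` with given coordinates, as values of odd generators. -/
def oddPoint (b : ℕ → Fin 3 → F) (α : ℕ → F) (j : ℕ) : b2Grading F 1 :=
  ⟨b2O (b j) (α j), b2O_mem _ _⟩

/-- The element of `sl₂` by whose bracket `adjOp` acts on even elements. -/
def adjValue (a b : ℕ → Fin 3 → F) (α : ℕ → F) : ℕ ⊕ ℕ × ℕ → Fin 3 → F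
  | .inl i => a i
  | .inr (i, j) => α i • b j

variable [CharZero F]

theorem eval_adjOp (a b : ℕ → Fin 3 → F) (α : ℕ → F) (t : ℕ ⊕ ℕ × ℕ)
    {f : FreeLieSuperalgebra F ℕ ℕ} {z : Fin 3 → F}
    (hf : eval (b2Grading F) (evenPoint a) (oddPoint b α) f = b2E z) :
    eval (b2Grading F) (evenPoint a) (oddPoint b α) (adjOp F t f) =
      b2E (slBracket (adjValue a b α t) z) := by
  rcases t with i | ⟨i, j⟩
  · simp only [adjOp, LinearMap.mulLeft_apply, eval_mul, hf, eval_letter_inl]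
    exact b2E_mul_b2E _ _
  · simp only [adjOp, Module.End.mul_apply, LinearMap.mulLeft_apply, eval_mul, hf,
      eval_letter_inr]
    exact b2O_mul_b2O_mul_b2E _ _ _ _ _

theorem eval_standardOp (a b : ℕ → Fin 3 → F) (α : ℕ → F) (s t u : ℕ ⊕ ℕ × ℕ)
    {f : FreeLieSuperalgebra F ℕ ℕ} {z : Fin 3 → F}
    (hf : eval (b2Grading F) (evenPoint a) (oddPoint b α) f = b2E z) :
    eval (b2Grading F) (evenPoint a) (oddPoint b α)
      (standardOp (adjOp F s) (adjOp F t) (adjOp F u) f) =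
      b2E ((-8 * tripleDet (adjValue a b α s) (adjValue a b α t) (adjValue a b α u)) • z) := by
  have h := fun x y w : ℕ ⊕ ℕ × ℕ =>
    eval_adjOp a b α x (eval_adjOp a b α y (eval_adjOp a b α w hf))
  simp only [standardOp, LinearMap.sub_apply, LinearMap.add_apply, Module.End.mul_apply, map_sub,
    map_add, h]
  rw [← slBracket_standard, b2E_sub, b2E_add, b2E_sub, b2E_add, b2E_sub]

/-- Each column acts as a scalar, so the value vanishes as soon as one column receives linearly
dependent vectors. -/
theorem eval_columnsPoly (a b : ℕ → Fin 3 → F) (α : ℕ → F) (T : ℕ → ℕ ⊕ ℕ × ℕ)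
    (C : Fin 3 → ℕ → ℕ) (z p : ℕ) :
    eval (b2Grading F) (evenPoint a) (oddPoint b α) (columnsPoly F T C z p) =
      b2E ((∏ i ∈ Finset.range p, (-8 * tripleDet (adjValue a b α (T (C 0 i)))
        (adjValue a b α (T (C 1 i))) (adjValue a b α (T (C 2 i))))) • a z) := by
  induction p with
  | zero =>
    simp only [columnsPoly, eval_letter_inl, Finset.range_zero, Finset.prod_empty, one_smul]
    rfl
  | succ p ih =>
    rw [columnsPoly, eval_standardOp a b α _ _ _ ih, Finset.prod_range_succ, smul_smul, mul_comm]

end Operators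

/-! ### Growth of the number of standard tableaux -/

/-- The number of standard Young tableaux with rows of lengths `a ≥ b ≥ c`. -/
def tableauCount (a b c : ℕ) : ℝ :=
  (a + b + c).factorial * ((a : ℝ) - b + 1) * ((a : ℝ) - c + 2) * ((b : ℝ) - c + 1) /
    ((a + 2).factorial * (b + 1).factorial * c.factorial)

theorem tableauCount_zero : tableauCount 0 0 0 = 1 := by
  norm_num [tableauCount]

/-- On shapes just outside the partition cone the formula vanishes, so the branching recursion needs
no separate treatment of rows of equal length. -/
theorem tableauCount_eq_zero_left (a c : ℕ) : tableauCount a (a + 1) c = 0 := by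
  simp [tableauCount]

theorem tableauCount_eq_zero_right (a b : ℕ) : tableauCount a b (b + 1) = 0 := by
  simp [tableauCount]

theorem tableauCount_row (a : ℕ) : tableauCount a 0 0 = 1 := by
  have h : ((a + 2).factorial : ℝ) = (a + 2) * ((a + 1) * a.factorial) := by
    push_cast [Nat.factorial_succ]; ring
  have h0 : (a.factorial : ℝ) ≠ 0 := by positivity
  have h1 : (a : ℝ) + 1 ≠ 0 := by positivity
  have h2 : (a : ℝ) + 2 ≠ 0 := by positivity
  simp only [tableauCount, h, add_zero, zero_add, Nat.factorial_one, Nat.factorial_zero,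
    Nat.cast_zero, Nat.cast_one]
  field_simp
  ring

theorem tableauCount_two_rows (a b : ℕ) :
    tableauCount (a + 1) (b + 1) 0 = tableauCount a (b + 1) 0 + tableauCount (a + 1) b 0 := by
  have ha : ((a + 1 + 2).factorial : ℝ) = (a + 3) * (a + 2).factorial := by
    push_cast [Nat.factorial_succ]; ring
  have hb : ((b + 1 + 1).factorial : ℝ) = (b + 2) * (b + 1).factorial := by
    push_cast [Nat.factorial_succ]; ring
  have hn : ((a + 1 + (b + 1)).factorial : ℝ) = (a + b + 2) * (a + b + 1).factorial := by
    rw [show a + 1 + (b + 1) = a + b + 1 + 1 by ring, Nat.factorial_succ]; push_cast; ring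
  have h0 : ((a + 2).factorial : ℝ) ≠ 0 := by positivity
  have h1 : ((b + 1).factorial : ℝ) ≠ 0 := by positivity
  have h2 : (a : ℝ) + 3 ≠ 0 := by positivity
  have h3 : (b : ℝ) + 2 ≠ 0 := by positivity
  simp only [tableauCount, add_zero, ha, hb, hn, show a + (b + 1) = a + b + 1 by ring,
    show a + 1 + b = a + b + 1 by ring]
  push_cast
  field_simp
  ring

theorem tableauCount_three_rows (a b c : ℕ) :
    tableauCount (a + 1) (b + 1) (c + 1) = tableauCount a (b + 1) (c + 1)
      + tableauCount (a + 1) b (c + 1) + tableauCount (a + 1) (b + 1) c := by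
  have ha : ((a + 1 + 2).factorial : ℝ) = (a + 3) * (a + 2).factorial := by
    push_cast [Nat.factorial_succ]; ring
  have hb : ((b + 1 + 1).factorial : ℝ) = (b + 2) * (b + 1).factorial := by
    push_cast [Nat.factorial_succ]; ring
  have hc : ((c + 1).factorial : ℝ) = (c + 1) * c.factorial := by
    push_cast [Nat.factorial_succ]; ring
  have hn : ((a + 1 + (b + 1) + (c + 1)).factorial : ℝ)
      = (a + b + c + 3) * (a + b + c + 2).factorial := by
    rw [show a + 1 + (b + 1) + (c + 1) = a + b + c + 2 + 1 by ring, Nat.factorial_succ]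
    push_cast; ring
  have h0 : ((a + 2).factorial : ℝ) ≠ 0 := by positivity
  have h1 : ((b + 1).factorial : ℝ) ≠ 0 := by positivity
  have h2 : (a : ℝ) + 3 ≠ 0 := by positivity
  have h3 : (b : ℝ) + 2 ≠ 0 := by positivity
  have h4 : (c.factorial : ℝ) ≠ 0 := by positivity
  have h5 : (c : ℝ) + 1 ≠ 0 := by positivity
  simp only [tableauCount, ha, hb, hc, hn, show a + (b + 1) + (c + 1) = a + b + c + 2 by ring,
    show a + 1 + b + (c + 1) = a + b + c + 2 by ring,
    show a + 1 + (b + 1) + c = a + b + c + 2 by ring]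
  push_cast
  field_simp
  ring

/-- Induction on the exact ratio of consecutive values. The true order is `27^p / p^4`; the fifth
power leaves slack that makes the inductive step hold from `p = 0` on. -/
theorem pow_le_tableauCount (p : ℕ) :
    (27 : ℝ) ^ p ≤ tableauCount p p p * ((p : ℝ) + 1) ^ 5 := by
  induction p with
  | zero => simp [tableauCount_zero]
  | succ p ih =>
    -- The constant `2/9` comes from `(3p+1)(3p+2) = 9(p^2 + p + 2/9)`.
    have hstep : tableauCount (p + 1) (p + 1) (p + 1) * (((p : ℝ) + 2) * (p + 3)) =
        tableauCount p p p * (27 * ((p : ℝ) ^ 2 + p + 2 / 9)) := by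
      have ha : ((p + 1 + 2).factorial : ℝ) = (p + 3) * (p + 2).factorial := by
        push_cast [Nat.factorial_succ]; ring
      have hb : ((p + 1 + 1).factorial : ℝ) = (p + 2) * (p + 1).factorial := by
        push_cast [Nat.factorial_succ]; ring
      have hc : ((p + 1).factorial : ℝ) = (p + 1) * p.factorial := by
        push_cast [Nat.factorial_succ]; ring
      have hn : ((p + 1 + (p + 1) + (p + 1)).factorial : ℝ)
          = (3 * p + 3) * ((3 * p + 2) * ((3 * p + 1) * (p + p + p).factorial)) := by
        rw [show p + 1 + (p + 1) + (p + 1) = p + p + p + 1 + 1 + 1 by ring, Nat.factorial_succ,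
          Nat.factorial_succ, Nat.factorial_succ]
        push_cast; ring
      have h0 : ((p + 2).factorial : ℝ) ≠ 0 := by positivity
      have h1 : (p.factorial : ℝ) ≠ 0 := by positivity
      have h2 : (p : ℝ) + 3 ≠ 0 := by positivity
      have h3 : (p : ℝ) + 2 ≠ 0 := by positivity
      have h4 : (p : ℝ) + 1 ≠ 0 := by positivity
      simp only [tableauCount, ha, hb, hc, hn]
      push_cast
      field_simp
      ring
    have hp : (0 : ℝ) ≤ p := p.cast_nonneg
    have hden : (0 : ℝ) < ((p : ℝ) + 2) * (p + 3) * (p + 1) ^ 5 := by positivity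
    refine le_of_mul_le_mul_right ?_ hden
    have hpoly : ((p : ℝ) + 2) * (p + 3) * (p + 1) ^ 5 ≤
        (p ^ 2 + p + 2 / 9) * ((p : ℝ) + 2) ^ 5 := by
      have h : ((p : ℝ) + 3) * (p + 1) ^ 5 ≤ (p ^ 2 + p + 2 / 9) * ((p : ℝ) + 2) ^ 4 := by
        have : 0 ≤ (p ^ 2 + p + 2 / 9) * ((p : ℝ) + 2) ^ 4 - ((p : ℝ) + 3) * (p + 1) ^ 5 := by
          -- The leading terms cancel and all remaining coefficients are positive.
          ring_nf; positivity
        linarith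
      nlinarith [mul_le_mul_of_nonneg_left h (show (0 : ℝ) ≤ p + 2 by positivity)]
    push_cast
    calc (27 : ℝ) ^ (p + 1) * (((p : ℝ) + 2) * (p + 3) * (p + 1) ^ 5)
        ≤ 27 ^ (p + 1) * ((p ^ 2 + p + 2 / 9) * ((p : ℝ) + 2) ^ 5) := by gcongr
      _ = 27 ^ p * (27 * (p ^ 2 + p + 2 / 9) * ((p : ℝ) + 2) ^ 5) := by ring
      _ ≤ (tableauCount p p p * ((p : ℝ) + 1) ^ 5) *
          (27 * (p ^ 2 + p + 2 / 9) * ((p : ℝ) + 2) ^ 5) := by gcongr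
      _ = (tableauCount p p p * (27 * (p ^ 2 + p + 2 / 9))) *
          (((p : ℝ) + 1) ^ 5 * ((p : ℝ) + 2) ^ 5) := by ring
      _ = _ := by rw [← hstep]; ring

/-! ### Standard tableaux and their words -/

/-- `w` is the row-reading word (letter number `s` is placed in row `w s`) of the standard tableau
whose entry in row `k` and column `i` is `C k i`. -/
structure IsTableau (a b c : ℕ) (w : ℕ → Fin 3) (C : Fin 3 → ℕ → ℕ) : Prop where
  lt_size : ∀ k i, i < ![a, b, c] k → C k i < a + b + c
  row_eq : ∀ k i, i < ![a, b, c] k → w (C k i) = k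
  injOn : ∀ k i j, i < ![a, b, c] k → j < ![a, b, c] k → C k i = C k j → i = j
  lt_one : ∀ i, i < b → C 0 i < C 1 i
  lt_two : ∀ i, i < c → C 1 i < C 2 i
  eq_zero : ∀ s, a + b + c ≤ s → w s = 0

/-- The new largest entry goes to the end of row `k`, so the order within columns persists whenever
the new shape is still a partition. -/
theorem IsTableau.snoc {a b c : ℕ} {w : ℕ → Fin 3} {C : Fin 3 → ℕ → ℕ}
    (h : IsTableau a b c w C) (hb : b ≤ a) (hc : c ≤ b) (k : Fin 3) {a' b' c' : ℕ}
    (hshape : ![a', b', c'] = Function.update ![a, b, c] k (![a, b, c] k + 1))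
    (hb' : b' ≤ a') (hc' : c' ≤ b') :
    IsTableau a' b' c' (Function.update w (a + b + c) k)
      (Function.update C k (Function.update (C k) (![a, b, c] k) (a + b + c))) := by
  obtain ⟨h1, h2, h3, h4, h5, h6⟩ := h
  have e0 := congrFun hshape 0
  have e1 := congrFun hshape 1
  have e2 := congrFun hshape 2
  simp only [Fin.forall_fin_succ, Fin.isValue, Matrix.cons_val_zero, Matrix.cons_val_succ,
    Matrix.cons_val_fin_one, IsEmpty.forall_iff, and_true, Fin.succ_zero_eq_one,
    Fin.succ_one_eq_two] at h1 h2 h3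
  fin_cases k <;>
  · simp at e0 e1 e2
    subst e0 e1 e2
    constructor <;>
    simp [Fin.forall_fin_succ, Function.update_apply] <;> grind

/-- Removing the largest entry turns the tableaux of a shape into those of the shapes with one
corner fewer, matching the recursion of `tableauCount`. An inequality for the cardinality is enough.
-/
theorem exists_tableaux (N : ℕ) : ∀ a b c : ℕ, a + b + c = N → b ≤ a → c ≤ b →
    ∃ s : Finset (ℕ → Fin 3), tableauCount a b c ≤ s.card ∧
      ∀ w ∈ s, ∃ C, IsTableau a b c w C := by
  classical
  induction N with
  | zero =>
    intro a b c h _ _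
    obtain ⟨rfl, rfl, rfl⟩ : a = 0 ∧ b = 0 ∧ c = 0 := by omega
    refine ⟨{fun _ => 0}, by simp [tableauCount_zero], fun w hw => ⟨fun _ _ => 0, ?_⟩⟩
    rw [Finset.mem_singleton.1 hw]
    constructor <;> simp [Fin.forall_fin_succ]
  | succ N ih =>
    intro a b c hN hb hc
    -- The set for `k` holds the words whose last letter is `k`; it is empty when row `k` has no
    -- removable corner.
    have key : ∀ (k : Fin 3), ∃ s : Finset (ℕ → Fin 3),
        (∀ w ∈ s, w N = k ∧ ∃ C, IsTableau a b c w C) ∧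
        ∀ a' b' c' : ℕ, ![a, b, c] = Function.update ![a', b', c'] k (![a', b', c'] k + 1) →
          b' ≤ a' → c' ≤ b' → tableauCount a' b' c' ≤ s.card := by
      intro k
      by_cases hex : ∃ a' b' c' : ℕ, ![a, b, c] =
          Function.update ![a', b', c'] k (![a', b', c'] k + 1) ∧ b' ≤ a' ∧ c' ≤ b'
      · obtain ⟨a', b', c', hs, hb', hc'⟩ := hex
        have e0 := congrFun hs 0
        have e1 := congrFun hs 1
        have e2 := congrFun hs 2
        have hN' : a' + b' + c' = N := by
          fin_cases k <;> simp at e0 e1 e2 <;> omega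
        obtain ⟨s, hcard, hs'⟩ := ih a' b' c' hN' hb' hc'
        have hinj : Set.InjOn (fun w : ℕ → Fin 3 => Function.update w N k) s := by
          intro w hw w' hw' heq
          obtain ⟨C, hC⟩ := hs' w hw
          obtain ⟨C', hC'⟩ := hs' w' hw'
          ext1 i
          -- Appending a letter overwrites position `N`; injectivity survives because words are
          -- normalised to 0 beyond their size.
          by_cases hi : i = N
          · rw [hC.eq_zero i (by omega), hC'.eq_zero i (by omega)]
          · simpa [Function.update_apply, hi] using congrFun heq i
        refine ⟨s.image fun w => Function.update w N k, ?_, ?_⟩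
        · intro w hw
          obtain ⟨v, hv, rfl⟩ := Finset.mem_image.1 hw
          obtain ⟨C, hC⟩ := hs' v hv
          have h := hC.snoc hb' hc' k hs hb hc
          rw [hN'] at h
          exact ⟨by simp, _, h⟩
        · intro a'' b'' c'' hs'' _ _
          have : a'' = a' ∧ b'' = b' ∧ c'' = c' := by
            have f0 := congrFun hs'' 0
            have f1 := congrFun hs'' 1
            have f2 := congrFun hs'' 2
            fin_cases k <;> simp at e0 e1 e2 f0 f1 f2 <;> omega
          obtain ⟨rfl, rfl, rfl⟩ := this
          rw [Finset.card_image_of_injOn hinj]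
          exact hcard
      · refine ⟨∅, by simp, fun a' b' c' h1 h2 h3 => absurd ⟨a', b', c', h1, h2, h3⟩ hex⟩
    choose s hs hcard using key
    have hdisj : Set.PairwiseDisjoint (Finset.univ : Finset (Fin 3)) s := by
      intro i _ j _ hij
      refine Finset.disjoint_left.2 fun w hi hj => hij ?_
      rw [← (hs i w hi).1, ← (hs j w hj).1]
    refine ⟨Finset.univ.biUnion s, ?_, fun w hw => ?_⟩
    · rw [Finset.card_biUnion hdisj]
      simp only [Fin.sum_univ_three]
      push_cast
      have h0 : ∀ a', a = a' + 1 → tableauCount a' b c ≤ (s 0).card := by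
        rintro a' rfl
        rcases hb.lt_or_eq with h | rfl
        · exact hcard 0 a' b c (by ext i; fin_cases i <;> simp) (by omega) hc
        · simp [tableauCount_eq_zero_left]
      have h1 : ∀ b', b = b' + 1 → tableauCount a b' c ≤ (s 1).card := by
        rintro b' rfl
        rcases hc.lt_or_eq with h | rfl
        · exact hcard 1 a b' c (by ext i; fin_cases i <;> simp) (by omega) (by omega)
        · simp [tableauCount_eq_zero_right]
      have h2 : ∀ c', c = c' + 1 → tableauCount a b c' ≤ (s 2).card := by
        rintro c' rfl
        exact hcard 2 a b c' (by ext i; fin_cases i <;> simp) (by omega) (by omega)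
      have n0 : (0 : ℝ) ≤ (s 0).card := by positivity
      have n1 : (0 : ℝ) ≤ (s 1).card := by positivity
      have n2 : (0 : ℝ) ≤ (s 2).card := by positivity
      rcases a with _ | a
      · omega
      rcases b with _ | b
      · obtain rfl : c = 0 := by omega
        have := h0 a rfl
        rw [tableauCount_row] at this ⊢
        linarith
      rcases c with _ | c
      · rw [tableauCount_two_rows]
        linarith [h0 a rfl, h1 b rfl]
      · rw [tableauCount_three_rows]
        linarith [h0 a rfl, h1 b rfl, h2 c rfl]
    · obtain ⟨k, -, hk⟩ := Finset.mem_biUnion.1 hw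
      exact (hs k w hk).2

/-- Listing a set of odd generators and its complement in parallel yields the pairing; `idx`
recovers the pair to which a generator belongs. -/
theorem exists_enumeration {S : Finset ℕ} {r : ℕ} (hS : S.card = r) :
    ∃ σ idx : ℕ → ℕ, (∀ i < r, idx (σ i) = i) ∧ S.val = (Multiset.range r).map σ := by
  have hlen : S.toList.length = r := by simpa using hS
  refine ⟨fun i => S.toList.getD i 0, fun j => S.toList.idxOf j, fun i hi => ?_, ?_⟩
  · have hi' : i < S.toList.length := hlen ▸ hi
    simp only [List.getD_eq_getElem _ _ hi']
    exact S.nodup_toList.idxOf_getElem i hi'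
  · have h : (List.range r).map (fun i => S.toList.getD i 0) = S.toList := by
      refine List.ext_getElem (by simp [hlen]) fun i h1 h2 => ?_
      simp only [List.getElem_map, List.getElem_range, List.getD_eq_getElem _ _ h2]
    exact (Finset.coe_toList S).symm.trans (congrArg _ h.symm)

theorem sum_range_singleton {α : Type*} (g : ℕ → α) (n : ℕ) :
    ∑ i ∈ Finset.range n, ({g i} : Multiset α) = (Multiset.range n).map g := by
  induction n with
  | zero => simp
  | succ n ih =>
    rw [Finset.sum_range_succ, ih, Multiset.range_succ, Multiset.map_cons, add_comm,
      Multiset.singleton_add]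

namespace IsTableau

variable {p : ℕ} {w : ℕ → Fin 3} {C : Fin 3 → ℕ → ℕ}

/-- Entries in different rows differ because `w` reads off the row, so a cardinality count shows
that the tableau uses every number exactly once. -/
theorem image_eq_range (h : IsTableau p p p w C) :
    Set.InjOn (fun x : ℕ × Fin 3 => C x.2 x.1) (Finset.range p ×ˢ Finset.univ : Finset (ℕ × Fin 3)) ∧
    (Finset.range p ×ˢ Finset.univ).image (fun x : ℕ × Fin 3 => C x.2 x.1)
      = Finset.range (p + p + p) := by
  have hshape : ∀ k, ![p, p, p] k = p := fun k => by fin_cases k <;> rfl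
  have hinj : Set.InjOn (fun x : ℕ × Fin 3 => C x.2 x.1)
      (Finset.range p ×ˢ Finset.univ : Finset (ℕ × Fin 3)) := by
    rintro ⟨i, k⟩ hx ⟨j, k'⟩ hy hxy
    simp only [Finset.coe_product, Finset.coe_range, Finset.coe_univ, Set.mem_prod, Set.mem_Iio,
      Set.mem_univ, and_true] at hx hy
    have hk : k = k' := by
      rw [← h.row_eq k i (by rwa [hshape]), ← h.row_eq k' j (by rwa [hshape])]
      exact congrArg w hxy
    subst hk
    rw [h.injOn k i j (by rwa [hshape]) (by rwa [hshape]) hxy]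
  refine ⟨hinj, Finset.eq_of_subset_of_card_le ?_ ?_⟩
  · intro s hs
    obtain ⟨⟨i, k⟩, hx, rfl⟩ := Finset.mem_image.1 hs
    have hi : i < p := by simpa using hx
    exact Finset.mem_range.2 (h.lt_size k i (by rwa [hshape]))
  · rw [Finset.card_image_of_injOn hinj]
    simp
    omega

theorem sum_eq {M : Type*} [AddCommMonoid M] (h : IsTableau p p p w C) (g : ℕ → M) :
    ∑ i ∈ Finset.range p, ∑ k : Fin 3, g (C k i) = ∑ s ∈ Finset.range (p + p + p), g s := by
  rw [← h.image_eq_range.2, Finset.sum_image h.image_eq_range.1, Finset.sum_product]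

theorem exists_eq (h : IsTableau p p p w C) {s : ℕ} (hs : s < p + p + p) :
    ∃ i k, i < p ∧ C k i = s := by
  have hs' := Finset.mem_range.2 hs
  rw [← h.image_eq_range.2] at hs'
  obtain ⟨⟨i, k⟩, hx, hC⟩ := Finset.mem_image.1 hs'
  exact ⟨i, k, by simpa using hx, hC⟩

/-- A relabelling with distinct labels in each column of a standard tableau is lexicographically
at least its row-reading word. -/
theorem toLex_le (h : IsTableau p p p w C) {v : ℕ → Fin 3} (hv0 : ∀ s, p + p + p ≤ s → v s = 0)
    (hv : ∀ i < p, v (C 0 i) ≠ v (C 1 i) ∧ v (C 0 i) ≠ v (C 2 i) ∧ v (C 1 i) ≠ v (C 2 i)) :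
    toLex w ≤ toLex v := by
  by_contra hlt
  -- At the first disagreement, the entries above `s` in its column are smaller, so `v` gives them
  -- their row numbers. A smaller label at `s` would then repeat one of these in the column.
  obtain ⟨s, hs1, hs2⟩ : ∃ s, (∀ t < s, v t = w t) ∧ v s < w s := not_le.1 hlt
  have hs : s < p + p + p := by
    by_contra hge
    rw [hv0 s (not_lt.1 hge), h.eq_zero s (not_lt.1 hge)] at hs2
    exact lt_irrefl _ hs2
  obtain ⟨i, k, hi, rfl⟩ := h.exists_eq hs
  obtain ⟨h1, h2, h3⟩ := hv i hi
  have r0 : w (C 0 i) = 0 := h.row_eq 0 i hi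
  have r1 : w (C 1 i) = 1 := h.row_eq 1 i hi
  have r2 : w (C 2 i) = 2 := h.row_eq 2 i hi
  have l1 := h.lt_one i hi
  have l2 := h.lt_two i hi
  fin_cases k
  · simp only [Fin.zero_eta] at hs2
    rw [r0] at hs2
    exact absurd hs2 (Fin.not_lt_zero _)
  · simp only [Fin.mk_one] at hs2 hs1
    rw [hs1 _ l1, r0] at h1
    rw [r1] at hs2
    omega
  · simp only [Fin.reduceFinMk] at hs2 hs1
    rw [hs1 _ (l1.trans l2), r0] at h2
    rw [hs1 _ l2, r1] at h3
    rw [r2] at hs2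
    omega

end IsTableau

/-! ### Independent multilinear polynomials from tableaux -/

section

variable {F : Type*} [Field F]

theorem tripleDet_single (a b c : Fin 3)
    (h : tripleDet (Pi.single a (1 : F)) (Pi.single b 1) (Pi.single c 1) ≠ 0) :
    a ≠ b ∧ a ≠ c ∧ b ≠ c := by
  refine ⟨?_, ?_, ?_⟩ <;> rintro rfl <;> refine h ?_ <;> simp only [tripleDet] <;> ring

theorem tripleDet_basis :
    tripleDet (Pi.single 0 (1 : F)) (Pi.single 1 1) (Pi.single 2 1) = 1 := by
  simp [tripleDet]

theorem tripleDet_eq_zero (u : Fin 3 → Fin 3 → F) {k : Fin 3} (hk : u k = 0) :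
    tripleDet (u 0) (u 1) (u 2) = 0 := by
  fin_cases k <;> simp at hk <;> simp [tripleDet, hk]

/-- The operators attached to `k` even generators and `r` pairs of odd generators. -/
def arrangement (k : ℕ) (σ τ : ℕ → ℕ) (s : ℕ) : ℕ ⊕ ℕ × ℕ :=
  if s < k then .inl s else .inr (σ (s - k), τ (s - k))

theorem sum_adjLetters_arrangement {k r : ℕ} {S : Finset ℕ} (hS : S ⊆ Finset.range (2 * r))
    {σ τ : ℕ → ℕ} (hσ : S.val = (Multiset.range r).map σ)
    (hτ : (Finset.range (2 * r) \ S).val = (Multiset.range r).map τ) :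
    ∑ s ∈ Finset.range (k + r), adjLetters (arrangement k σ τ s) + {.inl k} =
      (Multiset.range (k + 1)).map Sum.inl + (Multiset.range (2 * r)).map Sum.inr := by
  have h1 : ∑ s ∈ Finset.range k, adjLetters (arrangement k σ τ s) =
      (Multiset.range k).map Sum.inl := by
    rw [← sum_range_singleton]
    exact Finset.sum_congr rfl fun s hs => by
      simp [arrangement, Finset.mem_range.1 hs, adjLetters]
  have h2 : ∑ s ∈ Finset.range r, adjLetters (arrangement k σ τ (k + s)) =
      (Multiset.range (2 * r)).map Sum.inr := by
    have h : Multiset.range (2 * r) = S.val + (Finset.range (2 * r) \ S).val := by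
      rw [Finset.sdiff_val, add_tsub_cancel_of_le (Finset.val_le_iff.2 hS)]
      rfl
    rw [h, hσ, hτ, Multiset.map_add, Multiset.map_map, Multiset.map_map, ← sum_range_singleton,
      ← sum_range_singleton, ← Finset.sum_add_distrib]
    exact Finset.sum_congr rfl fun s _ => by simp [arrangement, adjLetters]
  rw [Finset.sum_range_add, h1, h2, Multiset.range_succ, Multiset.map_cons,
    ← Multiset.singleton_add]
  abel

/-- The family is indexed by pairs of an `r`-subset of the odd generators, which stand outside in
their pairs, and a tableau word. The ordering key is the word alone, since distinct subsets already
give zero. -/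
theorem choose_mul_card_le_partialCodim (F : Type*) [Field F] [CharZero F] {k r p : ℕ}
    (hkr : k + r = p + p + p) (W : Finset (ℕ → Fin 3))
    (hW : ∀ w ∈ W, ∃ C, IsTableau p p p w C) :
    (2 * r).choose r * W.card ≤ partialCodim (b2Grading F) (k + 1) (2 * r) := by
  classical
  let 𝒮 := Finset.powersetCard r (Finset.range (2 * r))
  have h𝒮 : ∀ S : 𝒮, S.1 ⊆ Finset.range (2 * r) ∧ S.1.card = r :=
    fun S => Finset.mem_powersetCard.1 S.2
  have h𝒮' : ∀ S : 𝒮, (Finset.range (2 * r) \ S.1).card = r := fun S => by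
    rw [Finset.card_sdiff_of_subset (h𝒮 S).1, (h𝒮 S).2, Finset.card_range]; omega
  choose σ _ _ hσ using fun S : 𝒮 => exists_enumeration (h𝒮 S).2
  choose τ idx hidx hτ using fun S : 𝒮 => exists_enumeration (h𝒮' S)
  choose C hC using fun w : W => hW w.1 w.2
  -- The generator acted upon has index `k` and takes the value `e`, so the coordinate of `e`
  -- returns exactly the scalar.
  let a : (ℕ → Fin 3) → ℕ → Fin 3 → F := fun w i =>
    if i < k then Pi.single (w i) 1 else Pi.single 0 1
  -- Generators outside `S` carry the basis vector prescribed by the word at their pair; for those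
  -- in `S` only the scalar `α` matters in the matching arrangement.
  let b : 𝒮 → (ℕ → Fin 3) → ℕ → Fin 3 → F := fun S w j => Pi.single (w (k + idx S j)) 1
  let α : 𝒮 → ℕ → F := fun S j => if j ∈ S.1 then 1 else 0
  have hval : ∀ (S : 𝒮) (w : W) (s : ℕ), s < p + p + p →
      adjValue (a w) (b S w) (α S) (arrangement k (σ S) (τ S) s) = Pi.single (w.1 s) 1 := by
    intro S w s hs
    by_cases hk : s < k
    · simp [arrangement, hk, adjValue, a]
    · have hmem : σ S (s - k) ∈ S.1 := by
        rw [← Finset.mem_val, hσ]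
        exact Multiset.mem_map_of_mem _ (Multiset.mem_range.2 (by omega))
      have hi := hidx S (s - k) (by omega)
      simp only [arrangement, hk, if_false, adjValue, α, hmem, if_true, b, hi, one_smul]
      rw [show k + (s - k) = s by omega]
  have heval : ∀ i j : 𝒮 × W, coordE F (eval (b2Grading F) (evenPoint (a i.2))
      (oddPoint (b i.1 i.2) (α i.1))
      (columnsPoly F (arrangement k (σ j.1) (τ j.1)) (C j.2) k p)) =
      ∏ t ∈ Finset.range p, (-8 * tripleDet
        (adjValue (a i.2) (b i.1 i.2) (α i.1) (arrangement k (σ j.1) (τ j.1) (C j.2 0 t)))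
        (adjValue (a i.2) (b i.1 i.2) (α i.1) (arrangement k (σ j.1) (τ j.1) (C j.2 1 t)))
        (adjValue (a i.2) (b i.1 i.2) (α i.1) (arrangement k (σ j.1) (τ j.1) (C j.2 2 t)))) := by
    intro i j
    rw [eval_columnsPoly, coordE_b2E]
    simp [a]
  have hlt : ∀ (w : W) (c : Fin 3) (t : ℕ), t < p → C w c t < p + p + p := fun w c t ht =>
    (hC w).lt_size c t (by fin_cases c <;> exact ht)
  have hcard := card_le_partialCodim (b2Grading F) (k := k + 1) (l := 2 * r)
    (fun i : 𝒮 × W => toLex i.2.1)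
    (fun i => columnsPoly F (arrangement k (σ i.1) (τ i.1)) (C i.2) k p) ?_
    (fun i => evenPoint (a i.2)) (fun i => oddPoint (b i.1 i.2) (α i.1)) (coordE F) ?_ ?_
  · simpa [𝒮, Fintype.card_prod] using hcard
  · intro i
    have h := columnsPoly_mem_wordSpan (F := F) (arrangement k (σ i.1) (τ i.1)) (C i.2) k p
    rwa [(hC i.2).sum_eq fun s => adjLetters (arrangement k (σ i.1) (τ i.1) s), ← hkr,
      sum_adjLetters_arrangement (h𝒮 i.1).1 (hσ i.1) (hτ i.1)] at h
  · intro i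
    rw [heval, Finset.prod_ne_zero_iff]
    intro t ht
    have ht := Finset.mem_range.1 ht
    rw [hval _ _ _ (hlt _ _ _ ht), hval _ _ _ (hlt _ _ _ ht), hval _ _ _ (hlt _ _ _ ht),
      (hC i.2).row_eq 0 t ht, (hC i.2).row_eq 1 t ht, (hC i.2).row_eq 2 t ht, tripleDet_basis]
    norm_num
  · rintro ⟨S', w'⟩ ⟨S, w⟩ hne
    rw [heval, Finset.prod_ne_zero_iff] at hne
    replace hne := fun t (ht : t < p) =>
      right_ne_zero_of_mul (hne t (Finset.mem_range.2 ht))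
    by_cases hSS : S = S'
    · subst hSS
      have hle : toLex w.1 ≤ toLex w'.1 := by
        refine (hC w).toLex_le (hC w').eq_zero fun t ht => tripleDet_single (F := F) _ _ _ ?_
        rw [← hval S w' _ (hlt w 0 t ht), ← hval S w' _ (hlt w 1 t ht),
          ← hval S w' _ (hlt w 2 t ht)]
        exact hne t ht
      rcases hle.lt_or_eq with h | h
      · exact Or.inr h
      · left
        rw [Subtype.ext (toLex.injective h)]
    · exfalso
      -- Such a generator stands outside in its pair but has scalar 0, so that operator acts as zero
      -- and kills its column.
      obtain ⟨j, hj, hj'⟩ : ∃ j ∈ S.1, j ∉ S'.1 := by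
        by_contra! hsub
        exact hSS (Subtype.ext (Finset.eq_of_subset_of_card_le hsub
          (by rw [(h𝒮 S).2, (h𝒮 S').2])))
      rw [← Finset.mem_val, hσ S] at hj
      obtain ⟨i, hi, rfl⟩ := Multiset.mem_map.1 hj
      have hi := Multiset.mem_range.1 hi
      obtain ⟨t, c, ht, hct⟩ := (hC w).exists_eq (s := k + i) (by omega)
      refine hne t ht (tripleDet_eq_zero (fun c => adjValue (a w') (b S' w') (α S')
        (arrangement k (σ S) (τ S) (C w c t))) (k := c) ?_)
      simp [hct, arrangement, adjValue, α, hj']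

theorem choose_mul_tableauCount_le_partialCodim (F : Type*) [Field F] [CharZero F] {k r p : ℕ}
    (hkr : k + r = p + p + p) :
    (2 * r).choose r * tableauCount p p p ≤ partialCodim (b2Grading F) (k + 1) (2 * r) := by
  obtain ⟨W, hcard, hW⟩ := exists_tableaux _ p p p rfl le_rfl le_rfl
  have h := choose_mul_card_le_partialCodim F hkr W hW
  calc ((2 * r).choose r : ℝ) * tableauCount p p p ≤ (2 * r).choose r * W.card := by gcongr
    _ ≤ partialCodim (b2Grading F) (k + 1) (2 * r) := by exact_mod_cast h

/-- The left-normed word `x₀ (x₁ (⋯ xₙ))` is not an identity of `b(2)`. -/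
theorem one_le_partialCodim (F : Type*) [Field F] [CharZero F] (n : ℕ) :
    1 ≤ partialCodim (b2Grading F) (n + 1) 0 := by
  let f : ℕ → FreeLieSuperalgebra F ℕ ℕ := fun m =>
    Nat.rec (letter F (.inl n)) (fun i g => adjOp F (.inl i) g) m
  -- Since `[h, e] = 2e`, repeated brackets with `h` never annihilate `e` in characteristic zero.
  let a : ℕ → Fin 3 → F := fun i => if i < n then Pi.single 1 1 else Pi.single 0 1
  have hmem : ∀ m, f m ∈ wordSpan F ((Multiset.range m).map Sum.inl + {.inl n}) := by
    intro m
    induction m with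
    | zero => simpa [f] using letter_mem_wordSpan (F := F) (Y := ℕ) (.inl n)
    | succ m ih =>
      rw [Multiset.range_succ, Multiset.map_cons, ← Multiset.singleton_add, add_assoc]
      exact adjOp_mem_wordSpan (.inl m) ih
  have heval : ∀ m ≤ n, eval (b2Grading F) (evenPoint a) (oddPoint 0 0) (f m) =
      b2E ((2 : F) ^ m • Pi.single 0 1) := by
    intro m
    induction m with
    | zero =>
      intro _
      rw [pow_zero, one_smul]
      refine (eval_letter_inl (b2Grading F) _ _ n).trans ?_
      simp [evenPoint, a]
    | succ m ih =>
      intro hm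
      refine (eval_adjOp a 0 0 (.inl m) (ih (by omega))).trans ?_
      congr 1
      simp only [adjValue, a, show m < n by omega, if_true]
      ext i
      fin_cases i <;> simp [slBracket, pow_succ]
      ring
  have h := card_le_partialCodim (b2Grading F) (k := n + 1) (l := 0) (ι := Unit) (fun i => i)
    (fun _ => f n) (fun _ => ?_) (fun _ => evenPoint a) (fun _ => oddPoint 0 0) (coordE F) ?_
    (fun _ _ _ => Or.inl rfl)
  · simpa using h
  · have h := hmem n
    rw [add_comm, Multiset.singleton_add, ← Multiset.map_cons, ← Multiset.range_succ] at h
    simpa [multilinearPart, wordSpan] using h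
  · intro _
    rw [heval n le_rfl, coordE_b2E]
    simp

end

/-! ### Comparison with the binomial expansion -/

theorem le_pow_mul_add {u : ℕ → ℝ} {n : ℕ} {M : ℝ} (hM : 0 ≤ M)
    (hup : ∀ k < n, u k ≤ M * u (k + 1)) (hdown : ∀ k < n, u (k + 1) ≤ M * u k) {k d : ℕ}
    (hkd : k + d ≤ n) : u k ≤ M ^ d * u (k + d) ∧ u (k + d) ≤ M ^ d * u k := by
  induction d with
  | zero => simp
  | succ d ih =>
    obtain ⟨h1, h2⟩ := ih (by omega)
    constructor
    · calc u k ≤ M ^ d * u (k + d) := h1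
        _ ≤ M ^ d * (M * u (k + d + 1)) := by gcongr; exact hup _ (by omega)
        _ = _ := by rw [pow_succ]; ring_nf
    · calc u (k + d + 1) ≤ M * u (k + d) := hdown _ (by omega)
        _ ≤ M * (M ^ d * u k) := by gcongr
        _ = _ := by rw [pow_succ]; ring

/-- The terms of the binomial expansion of `(3 + 2√3) ^ n`. -/
def expansionTerm (n k : ℕ) : ℝ := n.choose k * 3 ^ k * (2 * √3) ^ (n - k)

theorem sum_expansionTerm (n : ℕ) :
    ∑ k ∈ Finset.range (n + 1), expansionTerm n k = (3 + 2 * √3) ^ n := by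
  rw [add_pow]
  exact Finset.sum_congr rfl fun k _ => by rw [expansionTerm]; ring

theorem expansionTerm_nonneg (n k : ℕ) : 0 ≤ expansionTerm n k := by
  unfold expansionTerm; positivity

theorem sqrt_three_bounds : 3 / 2 ≤ √3 ∧ √3 ≤ 2 := by
  constructor
  · exact Real.le_sqrt_of_sq_le (by norm_num)
  · exact Real.sqrt_le_iff.2 (by norm_num)

theorem expansionTerm_succ {n k : ℕ} (hk : k < n) :
    expansionTerm n (k + 1) * (k + 1) * (2 * √3) = expansionTerm n k * (n - k) * 3 := by
  have h : (n.choose (k + 1) : ℝ) * (k + 1) = n.choose k * (n - k) := by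
    have := Nat.choose_succ_right_eq n k
    rw [← Nat.cast_sub hk.le]
    exact_mod_cast this
  have hexp : n - k = n - (k + 1) + 1 := by omega
  rw [expansionTerm, expansionTerm, hexp, pow_succ, pow_succ]
  linear_combination (3 ^ k * 3 * (2 * √3) ^ (n - (k + 1)) * (2 * √3)) * h

/-- The ratio of neighbours is `3(n - k) / (2√3 (k + 1))`; both integer factors lie between 1 and
`n`, so crude bounds on `√3` suffice. -/
theorem expansionTerm_le {n k : ℕ} (hk : k < n) :
    expansionTerm n k ≤ 2 * n * expansionTerm n (k + 1) ∧
    expansionTerm n (k + 1) ≤ 2 * n * expansionTerm n k := by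
  have h := expansionTerm_succ hk
  obtain ⟨h1, h2⟩ := sqrt_three_bounds
  have a0 := expansionTerm_nonneg n k
  have b0 := expansionTerm_nonneg n (k + 1)
  have hk' : (k : ℝ) + 1 ≤ n := by exact_mod_cast hk
  have hk0 : (0 : ℝ) ≤ k := k.cast_nonneg
  constructor
  · have e1 : expansionTerm n k * 3 ≤ expansionTerm n k * (n - k) * 3 := by
      have := mul_le_mul_of_nonneg_left (show (1 : ℝ) ≤ n - k by linarith) a0
      linarith
    have e2 : expansionTerm n (k + 1) * (k + 1) * (2 * √3) ≤
        expansionTerm n (k + 1) * n * (2 * 2) := by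
      gcongr
    have e3 : 0 ≤ expansionTerm n (k + 1) * n := by positivity
    linarith
  · have e1 : expansionTerm n k * (n - k) * 3 ≤ expansionTerm n k * n * 3 := by
      gcongr; linarith
    have e2 : expansionTerm n (k + 1) * 1 * (2 * (3 / 2)) ≤
        expansionTerm n (k + 1) * (k + 1) * (2 * √3) := by
      gcongr; linarith
    have e3 : 0 ≤ expansionTerm n k * n := by positivity
    linarith

/-- An index `m = k + 1` with `n - m = 2r` and `k + r = 3p` satisfies `m + n = 6p + 2`. Positivity
of `m` leaves an even generator to act upon. -/
theorem exists_near_residue {n k : ℕ} (hn : 6 ≤ n) (hk : k ≤ n) :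
    ∃ m, 1 ≤ m ∧ m ≤ n ∧ (m + n) % 6 = 2 ∧ m ≤ k + 6 ∧ k ≤ m + 6 := by
  by_cases h : 6 ≤ k
  · exact ⟨k - (k + n + 4) % 6, by omega, by omega, by omega, by omega, by omega⟩
  · exact ⟨1 + (1 + 5 * n) % 6, by omega, by omega, by omega, by omega, by omega⟩

theorem choose_mul_partialCodim_le (F : Type*) [Field F] [CharZero F] {n k : ℕ} (hk : k ≤ n) :
    n.choose k * partialCodim (b2Grading F) k (n - k) ≤ gradedCodim (b2Grading F) n :=
  Finset.single_le_sum (f := fun k => n.choose k * partialCodim (b2Grading F) k (n - k))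
    (fun _ _ => Nat.zero_le _) (Finset.mem_range.2 (by omega))

/-- One factor `n` pays for the central binomial coefficient against `4^r`, five for the tableau
count against `27^p`, and the 3 for the even generator acted upon. -/
theorem expansionTerm_le_gradedCodim (F : Type*) [Field F] [CharZero F] {n k : ℕ} (hk1 : 1 ≤ k)
    (hkn : k ≤ n) (hmod : (k + n) % 6 = 2) :
    expansionTerm n k ≤ 3 * n ^ 6 * gradedCodim (b2Grading F) n := by
  obtain ⟨m, rfl⟩ : ∃ m, k = m + 1 := ⟨k - 1, by omega⟩
  obtain ⟨r, hr⟩ : ∃ r, n - (m + 1) = 2 * r := ⟨(n - (m + 1)) / 2, by omega⟩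
  obtain ⟨p, hp⟩ : ∃ p, m + r = p + p + p := ⟨(m + r) / 3, by omega⟩
  have hcodim := choose_mul_tableauCount_le_partialCodim F hp
  have hsum := choose_mul_partialCodim_le F hkn
  rw [hr] at hsum
  have hsum' : (n.choose (m + 1) : ℝ) * partialCodim (b2Grading F) (m + 1) (2 * r) ≤
      gradedCodim (b2Grading F) n := by exact_mod_cast hsum
  have hcentral : (4 : ℝ) ^ r ≤ n * (2 * r).choose r := by
    rcases Nat.eq_zero_or_pos r with rfl | hr0
    · simp only [pow_zero, mul_zero, Nat.choose_self, Nat.cast_one, mul_one]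
      exact_mod_cast (by omega : 1 ≤ n)
    · have h := Nat.four_pow_le_two_mul_self_mul_centralBinom r hr0
      rw [Nat.centralBinom] at h
      have h' : 4 ^ r ≤ n * (2 * r).choose r :=
        h.trans (Nat.mul_le_mul_right _ (by omega))
      exact_mod_cast h'
  have htab : (27 : ℝ) ^ p ≤ tableauCount p p p * n ^ 5 := by
    have h := pow_le_tableauCount p
    -- The formula contains differences, so its sign is read off from the growth bound.
    have h0 : 0 ≤ tableauCount p p p := by
      by_contra hneg
      have h1 : tableauCount p p p * ((p : ℝ) + 1) ^ 5 ≤ 0 :=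
        mul_nonpos_of_nonpos_of_nonneg (not_le.1 hneg).le (by positivity)
      have h2 : (0 : ℝ) < 27 ^ p := by positivity
      linarith
    have hpn : (p : ℝ) + 1 ≤ n := by exact_mod_cast (by omega : p + 1 ≤ n)
    exact h.trans (by gcongr)
  have hterm : expansionTerm n (m + 1) = n.choose (m + 1) * (3 * (27 ^ p * 4 ^ r)) := by
    have hs : (2 * √3) ^ 2 = 12 := by
      rw [mul_pow, Real.sq_sqrt (by norm_num)]; norm_num
    have h3 : (3 : ℝ) ^ m * 3 ^ r = 27 ^ p := by
      rw [← pow_add, hp, show p + p + p = 3 * p by ring, pow_mul]; norm_num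
    rw [expansionTerm, hr, pow_mul, hs, ← h3, show (12 : ℝ) = 3 * 4 by norm_num, mul_pow]
    ring
  rw [hterm]
  calc (n.choose (m + 1) : ℝ) * (3 * (27 ^ p * 4 ^ r))
      ≤ n.choose (m + 1) * (3 * ((tableauCount p p p * n ^ 5) * (n * (2 * r).choose r))) := by
        gcongr
        exact (by positivity : (0 : ℝ) ≤ 27 ^ p).trans htab
    _ = 3 * n ^ 6 * (n.choose (m + 1) * ((2 * r).choose r * tableauCount p p p)) := by ring
    _ ≤ 3 * n ^ 6 * (n.choose (m + 1) * partialCodim (b2Grading F) (m + 1) (2 * r)) := by gcongr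
    _ ≤ 3 * n ^ 6 * gradedCodim (b2Grading F) n := by gcongr

theorem pow_le_gradedCodim (F : Type*) [Field F] [CharZero F] {n : ℕ} (hn : 1 ≤ n) :
    (3 + 2 * √3) ^ n ≤ 3 ^ 18 * (n : ℝ) ^ 38 * gradedCodim (b2Grading F) n := by
  have hn1 : (1 : ℝ) ≤ n := by exact_mod_cast hn
  set c : ℝ := ((gradedCodim (b2Grading F) n : ℕ) : ℝ)
  have hc0 : 0 ≤ c := by positivity
  rcases Nat.lt_or_ge n 6 with hsmall | hlarge
  -- Here a nearby admissible index may not exist; the codimension is at least 1 and the constant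
  -- `3^18` absorbs the rest.
  · have hc1 : 1 ≤ c := by
      have h := choose_mul_partialCodim_le F (le_refl n)
      obtain ⟨m, rfl⟩ : ∃ m, n = m + 1 := ⟨n - 1, by omega⟩
      rw [Nat.choose_self, one_mul, Nat.sub_self] at h
      exact Nat.one_le_cast.2 ((one_le_partialCodim F m).trans h)
    calc (3 + 2 * √3) ^ n ≤ 7 ^ n := by
          gcongr; linarith [sqrt_three_bounds.2]
      _ ≤ 7 ^ 5 := pow_le_pow_right₀ (by norm_num) (by omega)
      _ ≤ 3 ^ 18 * 1 * 1 := by norm_num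
      _ ≤ 3 ^ 18 * (n : ℝ) ^ 38 * c := by gcongr; exact one_le_pow₀ hn1
  · have hterm : ∀ k ∈ Finset.range (n + 1),
        expansionTerm n k ≤ (2 * n) ^ 6 * (3 * n ^ 6 * c) := by
      intro k hk
      obtain ⟨m, hm1, hmn, hmod, h1, h2⟩ :=
        exists_near_residue hlarge (Nat.lt_succ_iff.1 (Finset.mem_range.1 hk))
      have hkn := Nat.lt_succ_iff.1 (Finset.mem_range.1 hk)
      have hm := expansionTerm_le_gradedCodim F hm1 hmn hmod
      have hshift := fun (i d : ℕ) (h : i + d ≤ n) => le_pow_mul_add (u := expansionTerm n)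
        (M := 2 * n) (by positivity) (fun k hk => (expansionTerm_le hk).1)
        (fun k hk => (expansionTerm_le hk).2) h
      have hstep : ∃ d ≤ 6, expansionTerm n k ≤ (2 * n) ^ d * expansionTerm n m := by
        rcases le_total k m with hle | hle
        · refine ⟨m - k, by omega, ?_⟩
          have h := (hshift k (m - k) (by omega)).1
          rwa [Nat.add_sub_cancel' hle] at h
        · refine ⟨k - m, by omega, ?_⟩
          have h := (hshift m (k - m) (by omega)).2
          rwa [Nat.add_sub_cancel' hle] at h
      obtain ⟨d, hd, h⟩ := hstep
      calc expansionTerm n k ≤ (2 * n) ^ d * expansionTerm n m := h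
        _ ≤ (2 * n) ^ 6 * (3 * n ^ 6 * c) := by
          have := expansionTerm_nonneg n m
          have h2n : (1 : ℝ) ≤ 2 * n := by linarith
          gcongr
    have hsum := Finset.sum_le_card_nsmul _ _ _ hterm
    rw [sum_expansionTerm, Finset.card_range, nsmul_eq_mul] at hsum
    push_cast at hsum
    calc (3 + 2 * √3) ^ n ≤ ((n : ℝ) + 1) * ((2 * n) ^ 6 * (3 * n ^ 6 * c)) := hsum
      _ ≤ ((n : ℝ) + n) * ((2 * n) ^ 6 * (3 * n ^ 6 * c)) := by gcongr
      _ = 384 * (n : ℝ) ^ 13 * c := by ring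
      -- The argument costs only `384 n^13`, well within the stated factor.
      _ ≤ 3 ^ 18 * (n : ℝ) ^ 38 * c := by
        gcongr <;> norm_num

end

theorem lemma3 (F : Type*) [Field F] [CharZero F] (n : ℕ) (hn : 1 ≤ n) :
    ((n : ℤ) - 7 ≡ 0 [ZMOD 6] →
      1 / (3 ^ 18 * (n : ℝ) ^ 38) * (3 + 2 * √3) ^ n ≤ (gradedCodim (b2Grading F) n : ℝ)) ∧
    (∀ i : ℤ, 1 ≤ i → i ≤ 5 → (n : ℤ) - 7 ≡ i [ZMOD 6] →
      1 / (3 ^ 18 * (n : ℝ) ^ 43) * (3 + 2 * √3) ^ n ≤ (gradedCodim (b2Grading F) n : ℝ)) := by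
  have hn1 : (1 : ℝ) ≤ n := by exact_mod_cast hn
  have key : ∀ e : ℕ, 38 ≤ e →
      1 / (3 ^ 18 * (n : ℝ) ^ e) * (3 + 2 * √3) ^ n ≤ (gradedCodim (b2Grading F) n : ℝ) := by
    intro e he
    rw [one_div_mul_eq_div, div_le_iff₀ (by positivity), mul_comm (gradedCodim (b2Grading F) n : ℝ)]
    refine (pow_le_gradedCodim F hn).trans ?_
    gcongr
  exact ⟨fun _ => key 38 le_rfl, fun _ _ _ _ => key 43 (by norm_num)⟩
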